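/- **Theorem 3.3 (Complete transversal theorem for ${}_V\mathcal K$-equivalence).** Let $\mathbb K=\mathbb R$ or $\mathbb C$; "smooth" means $C^\infty$ if $\mathbb K=\mathbb R$ and holomorphic if $\mathbb K=\mathbb C$. Let $\mathcal E_p$ be the ring of germs at $0$ of smooth functions on $\mathbb K^p$, $\mathfrak m=\mathfrak m_p$ its ideal of germs vanishing at $0$, and for a smooth map germ $h:(\mathbb K^p,0)\to(\mathbb K^q,0)$ let $\theta(h)=\mathcal E_p^q$ and $h^*:\mathcal E_q\to\mathcal E_p$, $\varphi\mapsto\varphi\circ h$. Let $V$ be an arbitrary subset germ of $(\mathbb K^p,0)$. Let $\Theta_V\subseteq\mathcal E_p^p$ be the set of germs at $0$ of smooth vector fields $\xi$ whose local flow $(t,x)\mapsto\Phi_t(x)$ ($t\in\mathbb K$) preserves $V$, i.e. $x\in V\iff\Phi_t(x)\in V$ for all $(t,x)$ near $(0,0)$; let $\Theta_{V,1}$ be the set of those $\xi\in\Theta_V$ for which, for all $t$ near $0$, $\Phi_t$ fixes $0$ and has the same $1$-jet at $0$ as the identity. With $\xi(h)=\sum_i\xi_i\,\partial h/\partial x_i$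 put $$T_V\mathcal K_1(h)=\{\xi(h)\mid \xi\in\Theta_{V,1}\}+\mathfrak m_p\,h^*(\mathfrak m_q)\,\theta(h).$$ Two smooth map germs $f,\tilde f:(\mathbb K^p,0)\to(\mathbb K^q,0)$ are ${}_V\mathcal K_1$-equivalent if there is a germ of a diffeomorphism $\Psi$ of $(\mathbb K^p\times\mathbb K^q,0)$ with $\Psi(\mathbb K^p\times\{0\})=\mathbb K^p\times\{0\}$ and $\Psi(\operatorname{graph} f)=\operatorname{graph}\tilde f$ (as set germs at $0$), such that the diffeomorphism germ $\psi$ of $(\mathbb K^p,0)$ given by $\Psi(x,0)=(\psi(x),0)$ satisfies $\psi(V)=V$ and has $1$-jet at $0$ equal to the identity. Finally, $j^k(h)$ denotes the $k$-jet of $h$ at $0$, regarded as a polynomial map (the Taylor polynomial of degree $\le k$). Suppose that $\Theta_V$ is a finitely generated $\mathcal E_p$-module, let $h:(\mathbb K^p,0)\to(\mathbb K^q,0)$ be a smooth map germ, let $k\ge 0$, and let $g_1,\dots,g_s:\mathbb K^p\to\mathbb K^q$ be homogeneous polynomial maps of degree $k+1$ such that $$\mathfrak m^{k+1}\theta(h)\subseteq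 T_V\mathcal K_1(h)+\operatorname{span}_{\mathbb K}\{g_1,\dots,g_s\}+\mathfrak m^{k+2}\theta(h).$$ Then every smooth map germ $g:(\mathbb K^p,0)\to(\mathbb K^q,0)$ with $j^k(g)=j^k(h)$ is ${}_V\mathcal K_1$-equivalent to a smooth map germ $f:(\mathbb K^p,0)\to(\mathbb K^q,0)$ with $$j^{k+1}(f)=j^k(h)+\sum_{i=1}^s\alpha_i g_i\qquad\text{for some }\alpha_1,\dots,\alpha_s\in\mathbb K.$$ -/

import Mathlib

open Filter Topology
open scoped ContDiff Pointwise

noncomputable section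

namespace VK

/-- `f` is of class `C^∞` on a neighbourhood of `a`. Over `ℝ` this is smoothness near `a`, over `ℂ`
it is holomorphy near `a`. (For `𝕜 = ℝ`, `ContDiffAt 𝕜 ∞ f a` alone does not give one
neighbourhood on which `f` is `C^∞`.) -/
def SmoothNear (𝕜 : Type*) [RCLike 𝕜] {E F : Type*} [NormedAddCommGroup E] [NormedSpace 𝕜 E]
    [NormedAddCommGroup F] [NormedSpace 𝕜 F] (f : E → F) (a : E) : Prop :=
  ∀ᶠ x in 𝓝 a, ContDiffAt 𝕜 ∞ f x

/-- The ring of germs at `0` of smooth functions on `𝕜^p`. -/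
def smoothGerms (𝕜 : Type*) [RCLike 𝕜] (p : ℕ) :
    Subring (Germ (𝓝 (0 : Fin p → 𝕜)) 𝕜) where
  carrier := {φ | ∃ f : (Fin p → 𝕜) → 𝕜, SmoothNear 𝕜 f 0 ∧ φ = (f : Germ _ 𝕜)}
  mul_mem' := by
    rintro _ _ ⟨f, hf, rfl⟩ ⟨g, hg, rfl⟩
    exact ⟨f * g, by filter_upwards [hf, hg] with x h1 h2 using h1.mul h2, rfl⟩
  one_mem' := ⟨fun _ => 1, Eventually.of_forall fun _ => contDiffAt_const, rfl⟩
  add_mem' := by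
    rintro _ _ ⟨f, hf, rfl⟩ ⟨g, hg, rfl⟩
    exact ⟨f + g, by filter_upwards [hf, hg] with x h1 h2 using h1.add h2, rfl⟩
  zero_mem' := ⟨fun _ => 0, Eventually.of_forall fun _ => contDiffAt_const, rfl⟩
  neg_mem' := by
    rintro _ ⟨f, hf, rfl⟩
    exact ⟨-f, by filter_upwards [hf] with x h1 using h1.neg, rfl⟩

/-- `ℰ_p`, the ring of smooth function germs on `(𝕜^p, 0)`. -/
abbrev Ep (𝕜 : Type*) [RCLike 𝕜] (p : ℕ) : Type _ := ↥(smoothGerms 𝕜 p)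

/-- The germ at `0` of a function that is smooth near `0`. -/
def Ep.mk {𝕜 : Type*} [RCLike 𝕜] {p : ℕ} (f : (Fin p → 𝕜) → 𝕜) (hf : SmoothNear 𝕜 f 0) :
    Ep 𝕜 p :=
  ⟨(f : Germ (𝓝 (0 : Fin p → 𝕜)) 𝕜), f, hf, rfl⟩

/-- `𝔪_p`, the ideal of smooth germs that vanish at `0`. -/
def maxIdeal (𝕜 : Type*) [RCLike 𝕜] (p : ℕ) : Ideal (Ep 𝕜 p) :=
  RingHom.ker ((Germ.valueRingHom (x := (0 : Fin p → 𝕜)) (E := 𝕜)).comp (smoothGerms 𝕜 p).subtype)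

/-- The partial derivative `∂/∂x_i` on `ℰ_p`. -/
def pderiv {𝕜 : Type*} [RCLike 𝕜] {p : ℕ} (i : Fin p) (φ : Ep 𝕜 p) : Ep 𝕜 p :=
  ⟨Germ.map' (fun (f : (Fin p → 𝕜) → 𝕜) x => fderiv 𝕜 f x (Pi.single i 1))
      (fun _ _ h => (EventuallyEq.fderiv (𝕜 := 𝕜) h).mono fun x hx => by simp only [hx]) φ.1, by
    obtain ⟨_, f, hf, rfl⟩ := φ
    exact ⟨fun x => fderiv 𝕜 f x (Pi.single i 1), hf.mono fun x hx =>
      (hx.fderiv_right (m := ∞) le_rfl).clm_apply contDiffAt_const, rfl⟩⟩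

/-- A representative of a smooth map germ `(𝕜^p, 0) → (𝕜^q, 0)`; all notions below depend only on
its germ at `0`. -/
structure MapGerm (𝕜 : Type*) [RCLike 𝕜] (p q : ℕ) where
  toFun : (Fin p → 𝕜) → (Fin q → 𝕜)
  smooth' : SmoothNear 𝕜 toFun 0
  map_zero' : toFun 0 = 0

/-- The components of a map germ `h`, as an element of `θ(h) = (ℰ_p)^q`. -/
def MapGerm.comps {𝕜 : Type*} [RCLike 𝕜] {p q : ℕ} (h : MapGerm 𝕜 p q) : Fin q → Ep 𝕜 p :=
  fun j => Ep.mk (fun x => h.toFun x j) (h.smooth'.mono fun _ hx => contDiffAt_pi.1 hx j)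

theorem MapGerm.tendsto {𝕜 : Type*} [RCLike 𝕜] {p q : ℕ} (h : MapGerm 𝕜 p q) :
    Tendsto h.toFun (𝓝 0) (𝓝 0) := by
  simpa [ContinuousAt, h.map_zero'] using h.smooth'.self_of_nhds.continuousAt

/-- The ring homomorphism `h^* : ℰ_q → ℰ_p`, `φ ↦ φ ∘ h`. -/
def MapGerm.pullback {𝕜 : Type*} [RCLike 𝕜] {p q : ℕ} (h : MapGerm 𝕜 p q) :
    Ep 𝕜 q →+* Ep 𝕜 p where
  toFun φ := ⟨φ.1.compTendsto h.toFun h.tendsto, by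
    obtain ⟨_, f, hf, rfl⟩ := φ
    refine ⟨f ∘ h.toFun, ?_, rfl⟩
    filter_upwards [h.smooth', h.tendsto.eventually hf] with x h1 h2 using h2.comp x h1⟩
  map_one' := rfl
  map_zero' := rfl
  map_mul' := by
    rintro ⟨_, f, hf, rfl⟩ ⟨_, g, hg, rfl⟩
    rfl
  map_add' := by
    rintro ⟨_, f, hf, rfl⟩ ⟨_, g, hg, rfl⟩
    rfl

/-- The germ of a polynomial map `𝕜^p → 𝕜^q` in `(ℰ_p)^q`. -/
def polyGerm {𝕜 : Type*} [RCLike 𝕜] {p q : ℕ} (P : Fin q → MvPolynomial (Fin p) 𝕜) :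
    Fin q → Ep 𝕜 p :=
  fun j => Ep.mk (fun x => MvPolynomial.eval x (P j)) (Eventually.of_forall fun x =>
    ((AnalyticOnNhd.eval_mvPolynomial (P j)) x (Set.mem_univ x)).contDiffAt)

/-- `𝔪_p^n θ(h)`, where `θ(h) = (ℰ_p)^q`. -/
def powTheta (𝕜 : Type*) [RCLike 𝕜] (p q n : ℕ) : Submodule (Ep 𝕜 p) (Fin q → Ep 𝕜 p) :=
  (maxIdeal 𝕜 p ^ n) • (⊤ : Submodule (Ep 𝕜 p) (Fin q → Ep 𝕜 p))

/-- `Φ` is (a representative of the germ at `(0, 0)` of) the smooth local flow `(t, x) ↦ Φ_t(x)` of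
the vector field germ `ξ` on `𝕜^p`. The time `t` ranges over `𝕜`. -/
structure IsLocalFlow {𝕜 : Type*} [RCLike 𝕜] {p : ℕ} (ξ : Fin p → Ep 𝕜 p)
    (Φ : 𝕜 × (Fin p → 𝕜) → (Fin p → 𝕜)) : Prop where
  smooth : SmoothNear 𝕜 Φ 0
  initial : ∀ᶠ x in 𝓝 (0 : Fin p → 𝕜), Φ (0, x) = x
  ode : ∃ X : (Fin p → 𝕜) → (Fin p → 𝕜),
    (∀ i, (ξ i : Germ (𝓝 (0 : Fin p → 𝕜)) 𝕜) = ((fun x => X x i : (Fin p → 𝕜) → 𝕜) : Germ _ 𝕜)) ∧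
    ∀ᶠ z in 𝓝 (0 : 𝕜 × (Fin p → 𝕜)), HasDerivAt (fun t => Φ (t, z.2)) (X (Φ z)) z.1

/-- The local flow `Φ` preserves the germ at `0` of the set `V`. -/
def FlowPreserves {𝕜 : Type*} [RCLike 𝕜] {p : ℕ} (V : Set (Fin p → 𝕜))
    (Φ : 𝕜 × (Fin p → 𝕜) → (Fin p → 𝕜)) : Prop :=
  ∀ᶠ z in 𝓝 (0 : 𝕜 × (Fin p → 𝕜)), z.2 ∈ V ↔ Φ z ∈ V

/-- `Θ_V`: the vector field germs whose local flow preserves `V`. They need not vanish at `0`. -/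
def Theta {𝕜 : Type*} [RCLike 𝕜] {p : ℕ} (V : Set (Fin p → 𝕜)) : Set (Fin p → Ep 𝕜 p) :=
  {ξ | ∃ Φ, IsLocalFlow ξ Φ ∧ FlowPreserves V Φ}

/-- `ψ` fixes `0` and its 1-jet there is that of the identity. -/
def HasOneJetId {𝕜 : Type*} [RCLike 𝕜] {p : ℕ} (ψ : (Fin p → 𝕜) → (Fin p → 𝕜)) : Prop :=
  ψ 0 = 0 ∧ HasFDerivAt ψ (ContinuousLinearMap.id 𝕜 (Fin p → 𝕜)) 0

/-- `Θ_{V,1}`: the vector field germs whose local flow preserves `V` and consists of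
diffeomorphisms with 1-jet the identity. -/
def Theta1 {𝕜 : Type*} [RCLike 𝕜] {p : ℕ} (V : Set (Fin p → 𝕜)) : Set (Fin p → Ep 𝕜 p) :=
  {ξ | ∃ Φ, IsLocalFlow ξ Φ ∧ FlowPreserves V Φ ∧
    ∀ᶠ t in 𝓝 (0 : 𝕜), HasOneJetId fun x => Φ (t, x)}

/-- `Θ_V` is a finitely generated `ℰ_p`-module. -/
def ThetaFG {𝕜 : Type*} [RCLike 𝕜] {p : ℕ} (V : Set (Fin p → 𝕜)) : Prop :=
  ∃ N : Submodule (Ep 𝕜 p) (Fin p → Ep 𝕜 p), (N : Set (Fin p → Ep 𝕜 p)) = Theta V ∧ N.FG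

/-- `ξ(h) = ∑ i, ξ_i ∂h/∂x_i`. -/
def applyField {𝕜 : Type*} [RCLike 𝕜] {p q : ℕ} (ξ : Fin p → Ep 𝕜 p) (h : MapGerm 𝕜 p q) :
    Fin q → Ep 𝕜 p :=
  fun j => ∑ i, ξ i * pderiv i (h.comps j)

/-- The tangent space `T_V𝒦_1(h) = {ξ(h) | ξ ∈ Θ_{V,1}} + 𝔪_p h^*(𝔪_q) θ(h)`. -/
def tangentK1 {𝕜 : Type*} [RCLike 𝕜] {p q : ℕ} (V : Set (Fin p → 𝕜)) (h : MapGerm 𝕜 p q) :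
    Set (Fin q → Ep 𝕜 p) :=
  {v | ∃ ξ ∈ Theta1 V, v = applyField ξ h} +
    (((maxIdeal 𝕜 p * (maxIdeal 𝕜 q).map h.pullback) •
      (⊤ : Submodule (Ep 𝕜 p) (Fin q → Ep 𝕜 p)) : Submodule _ _) : Set (Fin q → Ep 𝕜 p))

/-- The `k`-jet at `0` of a map germ, as a polynomial map (the Taylor polynomial of degree `k`). -/
def jet {𝕜 : Type*} [RCLike 𝕜] {p q : ℕ} (k : ℕ) (h : MapGerm 𝕜 p q) (x : Fin p → 𝕜) : Fin q → 𝕜 :=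
  ∑ n ∈ Finset.range (k + 1),
    ((n.factorial : 𝕜)⁻¹) • iteratedFDeriv 𝕜 n h.toFun 0 (fun _ => x)

/-- `Ψ` represents a germ at `0` of a diffeomorphism `(E, 0) → (E, 0)`. -/
def IsDiffeoGerm (𝕜 : Type*) [RCLike 𝕜] {E : Type*} [NormedAddCommGroup E] [NormedSpace 𝕜 E]
    (Ψ : E → E) : Prop :=
  Ψ 0 = 0 ∧ SmoothNear 𝕜 Ψ 0 ∧ ∃ Ψ' : E → E, Ψ' 0 = 0 ∧ SmoothNear 𝕜 Ψ' 0 ∧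
    (∀ᶠ z in 𝓝 (0 : E), Ψ' (Ψ z) = z) ∧ ∀ᶠ z in 𝓝 (0 : E), Ψ (Ψ' z) = z

/-- For a diffeomorphism germ `Ψ`: the equality `Ψ(A) = B` of germs at `0` of sets. -/
def MapsGermOnto {E : Type*} [NormedAddCommGroup E] (Ψ : E → E) (A B : Set E) : Prop :=
  ∀ᶠ z in 𝓝 (0 : E), z ∈ A ↔ Ψ z ∈ B

/-- The graph of a map germ. -/
def MapGerm.graph {𝕜 : Type*} [RCLike 𝕜] {p q : ℕ} (f : MapGerm 𝕜 p q) :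
    Set ((Fin p → 𝕜) × (Fin q → 𝕜)) :=
  {z | z.2 = f.toFun z.1}

/-- `Ψ` is a `𝒦`-equivalence from `f` to `f'`: a diffeomorphism germ of `(𝕜^p × 𝕜^q, 0)` that maps
`𝕜^p × {0}` onto itself and the graph of `f` onto the graph of `f'`. -/
structure IsKEquivalence {𝕜 : Type*} [RCLike 𝕜] {p q : ℕ} (f f' : MapGerm 𝕜 p q)
    (Ψ : (Fin p → 𝕜) × (Fin q → 𝕜) → (Fin p → 𝕜) × (Fin q → 𝕜)) : Prop where
  diffeo : IsDiffeoGerm 𝕜 Ψ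
  preserves_zero : MapsGermOnto Ψ {z | z.2 = 0} {z | z.2 = 0}
  maps_graph : MapsGermOnto Ψ f.graph f'.graph

/-- The diffeomorphism germ of `(𝕜^p, 0)` that a `𝒦`-equivalence `Ψ` determines by restriction to
`𝕜^p × {0}`. -/
def baseMap {𝕜 : Type*} [RCLike 𝕜] {p q : ℕ}
    (Ψ : (Fin p → 𝕜) × (Fin q → 𝕜) → (Fin p → 𝕜) × (Fin q → 𝕜)) (x : Fin p → 𝕜) : Fin p → 𝕜 :=
  (Ψ (x, 0)).1

/-- `f` and `f'` are `_V𝒦_1`-equivalent: there is a `𝒦`-equivalence whose diffeomorphism of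
`(𝕜^p, 0)` preserves `V` and has 1-jet the identity. -/
def VK1Equiv {𝕜 : Type*} [RCLike 𝕜] {p q : ℕ} (V : Set (Fin p → 𝕜)) (f f' : MapGerm 𝕜 p q) : Prop :=
  ∃ Ψ, IsKEquivalence f f' Ψ ∧ MapsGermOnto (baseMap Ψ) V V ∧ HasOneJetId (baseMap Ψ)

end VK

end

/-! Subtract from the degree `k + 1` part of `g` a combination of the given polynomials. By
hypothesis the difference `e` can be chosen with `e_j ≡ ξ(h_j) + ∑ l, B_{jl} h_l` modulo terms of
order `k + 2`, where `ξ ∈ Θ_{V,1}` and the entries of the matrix `B` lie in `𝔪`. Here `h` may be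
replaced by `g`, because `ξ` vanishes to second order at `0`.

Let `N` be the ideal generated by `𝔪 ⟨g_1, …, g_q⟩` and the germs of order `k + 2`. Then `ξ(g) ≡ e`
and `ξ(e) ≡ 0` modulo `N`, and `ξ` preserves `N`, so the time-one flow of `ξ` would pull `g - e`
back to `g` modulo `N`. The flow exists only for small times, so a time-`1 / (n + 1)` map is
iterated instead; its exponential series can be cut off because each application of `ξ` raises the
order of vanishing. What remains is an element of `𝔪 ⟨g_1, …, g_q⟩`, up to order `k + 2`, and is
absorbed by a fibrewise linear map of `𝕜^p × 𝕜^q` that is the identity over `0`. -/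

noncomputable section

namespace VK

open Asymptotics

section Taylor

variable {𝕜 : Type*} [RCLike 𝕜] {E F : Type*} [NormedAddCommGroup E] [NormedSpace 𝕜 E]
  [NormedAddCommGroup F] [NormedSpace 𝕜 F]

theorem hasDerivAt_pow_succ_mul_inv_factorial (n : ℕ) (s : 𝕜) :
    HasDerivAt (fun s : 𝕜 => s ^ (n + 1) * ((n + 1).factorial : 𝕜)⁻¹)
      (s ^ n * (n.factorial : 𝕜)⁻¹) s := by
  refine ((hasDerivAt_pow (n + 1) s).mul_const ((n + 1).factorial : 𝕜)⁻¹).congr_deriv ?_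
  have : ((n : 𝕜) + 1) ≠ 0 := by exact_mod_cast n.succ_ne_zero
  rw [Nat.factorial_succ]
  push_cast
  field_simp

theorem norm_sub_sum_le_of_hasDerivAt {K : ℕ} {R C : ℝ} {u : ℕ → 𝕜 → F}
    (hu : ∀ n < K, ∀ s ∈ Metric.closedBall (0 : 𝕜) R, HasDerivAt (u n) (u (n + 1) s) s)
    (hC : ∀ s ∈ Metric.closedBall (0 : 𝕜) R, ‖u K s‖ ≤ C) :
    ∀ s ∈ Metric.closedBall (0 : 𝕜) R,
      ‖u 0 s - ∑ n ∈ Finset.range K, (s ^ n * (n.factorial : 𝕜)⁻¹) • u n 0‖ ≤ C * R ^ K := by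
  induction K generalizing u with
  | zero => simpa using hC
  | succ K ih =>
    intro s hs
    have hR : 0 ≤ R := (norm_nonneg s).trans (by simpa using hs)
    have hC0 : 0 ≤ C := (norm_nonneg _).trans (hC s hs)
    have hder : ∀ x ∈ Metric.closedBall (0 : 𝕜) R, HasDerivWithinAt
        (fun s => u 0 s - ∑ n ∈ Finset.range (K + 1), (s ^ n * (n.factorial : 𝕜)⁻¹) • u n 0)
        (u 1 x - ∑ n ∈ Finset.range K, (x ^ n * (n.factorial : 𝕜)⁻¹) • u (n + 1) 0)
        (Metric.closedBall (0 : 𝕜) R) x := by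
      intro x hx
      refine ((hu 0 K.succ_pos x hx).sub ?_).hasDerivWithinAt
      simp only [Finset.sum_range_succ', pow_zero, Nat.factorial_zero, Nat.cast_one, inv_one,
        mul_one, one_smul]
      exact (HasDerivAt.fun_sum fun n _ =>
        (hasDerivAt_pow_succ_mul_inv_factorial n x).smul_const _).add_const (u 0 0)
    have hmean := (convex_closedBall 0 R).norm_image_sub_le_of_norm_hasDerivWithin_le hder
      (ih (u := fun n => u (n + 1)) (fun n hn => hu (n + 1) (by omega)) hC)
      (Metric.mem_closedBall_self hR) hs
    have h0 : u 0 0 - ∑ n ∈ Finset.range (K + 1), ((0 : 𝕜) ^ n * (n.factorial : 𝕜)⁻¹) • u n 0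
        = 0 := by
      simp [Finset.sum_range_succ']
    rw [h0, sub_zero, sub_zero] at hmean
    calc _ ≤ C * R ^ K * ‖s‖ := hmean
      _ ≤ C * R ^ K * R := by gcongr; simpa using hs
      _ = C * R ^ (K + 1) := by ring

theorem hasDerivAt_iteratedFDeriv_add_smul {f : E → F} {x v : E} {s : 𝕜} (n : ℕ)
    (hf : ContDiffAt 𝕜 ∞ f (x + s • v)) :
    HasDerivAt (fun s : 𝕜 => iteratedFDeriv 𝕜 n f (x + s • v) (fun _ => v))
      (iteratedFDeriv 𝕜 (n + 1) f (x + s • v) (fun _ => v)) s := by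
  have hder : HasFDerivAt (iteratedFDeriv 𝕜 n f) _ (x + s • v) :=
    (hf.differentiableAt_iteratedFDeriv (by exact_mod_cast WithTop.coe_lt_top _)).hasFDerivAt
  have hline : HasDerivAt (fun s : 𝕜 => x + s • v) v s := by
    simpa using ((hasDerivAt_id s).smul_const v).const_add x
  exact (ContinuousMultilinearMap.apply 𝕜 (fun _ : Fin n => E) F
    (fun _ => v)).hasFDerivAt.comp_hasDerivAt s (hder.comp_hasDerivAt s hline)

theorem norm_sub_sum_iteratedFDeriv_le {f : E → F} {x v : E} {K : ℕ} {C : ℝ}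
    (hf : ∀ s ∈ Metric.closedBall (0 : 𝕜) 1, ContDiffAt 𝕜 ∞ f (x + s • v))
    (hC : ∀ s ∈ Metric.closedBall (0 : 𝕜) 1, ‖iteratedFDeriv 𝕜 K f (x + s • v)‖ ≤ C) :
    ∀ s ∈ Metric.closedBall (0 : 𝕜) 1,
      ‖f (x + s • v) - ∑ n ∈ Finset.range K,
        (s ^ n * (n.factorial : 𝕜)⁻¹) • iteratedFDeriv 𝕜 n f x (fun _ => v)‖ ≤ C * ‖v‖ ^ K := by
  intro s hs
  simpa using norm_sub_sum_le_of_hasDerivAt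
    (u := fun n s => iteratedFDeriv 𝕜 n f (x + s • v) (fun _ => v))
    (fun n _ s hs => hasDerivAt_iteratedFDeriv_add_smul n (hf s hs))
    (fun s hs => by
      simpa using ContinuousMultilinearMap.le_of_opNorm_le (hC s hs) fun _ => v) s hs

theorem SmoothNear.exists_ball_norm_iteratedFDeriv_le {f : E → F} {a : E}
    (hf : SmoothNear 𝕜 f a) (n : ℕ) :
    ∃ r > 0, ∃ C, ∀ x ∈ Metric.ball a r, ContDiffAt 𝕜 ∞ f x ∧ ‖iteratedFDeriv 𝕜 n f x‖ ≤ C := by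
  have hc : ContinuousAt (iteratedFDeriv 𝕜 n f) a :=
    (hf.self_of_nhds.iteratedFDeriv_right (m := 0) (i := n)
      (by simp only [zero_add]; exact_mod_cast le_top)).continuousAt
  obtain ⟨r, hr, hball⟩ := Metric.eventually_nhds_iff_ball.1
    (hf.and (hc.norm.eventually_le_const (lt_add_one _)))
  exact ⟨r, hr, _, hball⟩

/-- The Taylor polynomial of `f` at `0`, made of the terms of degree `< n`. -/
def taylorSum (𝕜 : Type*) [RCLike 𝕜] {E F : Type*} [NormedAddCommGroup E] [NormedSpace 𝕜 E]
    [NormedAddCommGroup F] [NormedSpace 𝕜 F] (n : ℕ) (f : E → F) (x : E) : F :=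
  ∑ j ∈ Finset.range n, ((j.factorial : 𝕜)⁻¹) • iteratedFDeriv 𝕜 j f 0 (fun _ => x)

theorem SmoothNear.sub_taylorSum_isBigO {f : E → F} (hf : SmoothNear 𝕜 f 0) (n : ℕ) :
    (fun x => f x - taylorSum 𝕜 n f x) =O[𝓝 0] fun x => ‖x‖ ^ n := by
  obtain ⟨r, hr, C, hball⟩ := hf.exists_ball_norm_iteratedFDeriv_le n
  refine IsBigO.of_bound C ?_
  filter_upwards [Metric.ball_mem_nhds 0 hr] with x hx
  have hmem : ∀ s ∈ Metric.closedBall (0 : 𝕜) 1, 0 + s • x ∈ Metric.ball (0 : E) r := by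
    intro s hs
    simp only [mem_closedBall_zero_iff, mem_ball_zero_iff, zero_add, norm_smul] at *
    exact (mul_le_of_le_one_left (norm_nonneg x) hs).trans_lt hx
  simpa [taylorSum] using norm_sub_sum_iteratedFDeriv_le (fun s hs => (hball _ (hmem s hs)).1)
    (fun s hs => (hball _ (hmem s hs)).2) 1 (by simp)

theorem eq_zero_of_sum_smul_isBigO {N : ℕ} {c : ℕ → F}
    (h : (fun t : 𝕜 => ∑ n ∈ Finset.range N, t ^ n • c n) =O[𝓝 0] fun t => ‖t‖ ^ N) :
    ∀ n < N, c n = 0 := by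
  induction N with
  | zero => simp
  | succ N ih =>
    have hlast : (fun t : 𝕜 => t ^ N • c N) =O[𝓝 0] fun t => ‖t‖ ^ N :=
      IsBigO.of_bound ‖c N‖ (Eventually.of_forall fun t => by simp [norm_smul, mul_comm])
    have hlower : ∀ n < N, c n = 0 :=
      ih <| ((h.trans (isLittleO_norm_pow_norm_pow N.lt_succ_self).isBigO).sub hlast).congr_left
        fun t => by rw [Finset.sum_range_succ, add_sub_cancel_right]
    have hterm : (fun t : 𝕜 => ContinuousMultilinearMap.mkPiRing 𝕜 (Fin N) (c N) fun _ => t)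
        =O[𝓝 0] fun t => ‖t‖ ^ (N + 1) := h.congr_left fun t => by
      rw [Finset.sum_range_succ, Finset.sum_eq_zero fun n hn => by
        rw [hlower n (Finset.mem_range.1 hn), smul_zero]]
      simp
    intro n hn
    rcases Nat.lt_succ_iff_lt_or_eq.1 hn with hn | rfl
    · exact hlower n hn
    · simpa using hterm.continuousMultilinearMap_apply_eq_zero 1

theorem iteratedFDeriv_diag_smul (j : ℕ) (f : E → F) (t : 𝕜) (x : E) :
    iteratedFDeriv 𝕜 j f 0 (fun _ => t • x) = t ^ j • iteratedFDeriv 𝕜 j f 0 (fun _ => x) := by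
  simpa using (iteratedFDeriv 𝕜 j f 0).map_smul_univ (fun _ => t) (fun _ => x)

theorem SmoothNear.smul_iteratedFDeriv_eq_of_isBigO {f : E → F} (hf : SmoothNear 𝕜 f 0) {N : ℕ}
    {c : ℕ → E → F} (hc : ∀ n < N, ∀ (t : 𝕜) x, c n (t • x) = t ^ n • c n x)
    (h : (fun x => f x - ∑ n ∈ Finset.range N, c n x) =O[𝓝 0] fun x => ‖x‖ ^ N) (n : ℕ)
    (hn : n < N) (x : E) :
    ((n.factorial : 𝕜)⁻¹) • iteratedFDeriv 𝕜 n f 0 (fun _ => x) = c n x := by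
  have hline : Tendsto (fun t : 𝕜 => t • x) (𝓝 0) (𝓝 0) := by
    simpa using (tendsto_id (x := 𝓝 (0 : 𝕜))).smul_const x
  have hdiff : (fun t : 𝕜 => ∑ n ∈ Finset.range N, t ^ n •
      (((n.factorial : 𝕜)⁻¹) • iteratedFDeriv 𝕜 n f 0 (fun _ => x) - c n x)) =O[𝓝 0]
      fun t => ‖t‖ ^ N := by
    refine (((h.sub (hf.sub_taylorSum_isBigO N)).comp_tendsto hline).congr_left fun t => ?_).trans
      (IsBigO.of_bound (‖x‖ ^ N) (Eventually.of_forall fun t => ?_))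
    · simp only [Function.comp_apply, sub_sub_sub_cancel_left, taylorSum,
        ← Finset.sum_sub_distrib]
      refine Finset.sum_congr rfl fun n hn => ?_
      rw [iteratedFDeriv_diag_smul, hc n (Finset.mem_range.1 hn), smul_comm, smul_sub]
    · simp [norm_smul, mul_pow, mul_comm]
  exact sub_eq_zero.1 (eq_zero_of_sum_smul_isBigO hdiff n hn)

theorem exists_sum_mul_pow_eq_ite {N m : ℕ} (hm : m < N) :
    ∃ w t : Fin N → 𝕜, (∀ i, ‖t i‖ ≤ 1) ∧
      ∀ j < N, ∑ i, w i * t i ^ j = if j = m then 1 else 0 := by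
  set t : Fin N → 𝕜 := fun i => (i : 𝕜) / N with ht
  have hN : (N : 𝕜) ≠ 0 := by exact_mod_cast (by omega : N ≠ 0)
  have hdet : IsUnit (Matrix.vandermonde t).det := by
    rw [isUnit_iff_ne_zero, Matrix.det_vandermonde_ne_zero_iff]
    intro i j hij
    exact Fin.ext (by exact_mod_cast (div_left_inj' hN).1 hij)
  refine ⟨(Matrix.vandermonde t)⁻¹ ⟨m, hm⟩, t, fun i => ?_, fun j hj => ?_⟩
  · rw [ht, norm_div, RCLike.norm_natCast, RCLike.norm_natCast]
    exact div_le_one_of_le₀ (by exact_mod_cast i.2.le) N.cast_nonneg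
  · have h := congr_fun₂ (Matrix.nonsing_inv_mul (Matrix.vandermonde t) hdet) ⟨m, hm⟩ ⟨j, hj⟩
    simpa [Matrix.mul_apply, Matrix.vandermonde_apply, Matrix.one_apply, eq_comm] using h

-- `a m` is a fixed linear combination of the values at `N` interpolation nodes.
theorem exists_norm_coeff_le {N m : ℕ} (hm : m < N) :
    ∃ M, 0 ≤ M ∧ ∀ (a : ℕ → F) (B : ℝ),
      (∀ t ∈ Metric.closedBall (0 : 𝕜) 1, ‖∑ n ∈ Finset.range N, t ^ n • a n‖ ≤ B) →
        ‖a m‖ ≤ M * B := by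
  obtain ⟨w, t, ht, hw⟩ := exists_sum_mul_pow_eq_ite (𝕜 := 𝕜) hm
  refine ⟨∑ i, ‖w i‖, by positivity, fun a B hB => ?_⟩
  have hcoeff : a m = ∑ i, w i • ∑ n ∈ Finset.range N, t i ^ n • a n := by
    simp only [Finset.smul_sum, smul_smul]
    rw [Finset.sum_comm]
    simp only [← Finset.sum_smul]
    rw [Finset.sum_eq_single_of_mem m (Finset.mem_range.2 hm), hw m hm, if_pos rfl, one_smul]
    intro n hn hnm
    rw [hw n (Finset.mem_range.1 hn), if_neg hnm, zero_smul]
  calc ‖a m‖ ≤ ∑ i, ‖w i • ∑ n ∈ Finset.range N, t i ^ n • a n‖ := by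
        rw [hcoeff]; exact norm_sum_le _ _
    _ ≤ ∑ i, ‖w i‖ * B := Finset.sum_le_sum fun i _ => by
        rw [norm_smul]
        gcongr
        exact hB _ (by simpa using ht i)
    _ = (∑ i, ‖w i‖) * B := (Finset.sum_mul ..).symm

theorem SmoothNear.fderiv {f : E → F} {a : E} (hf : SmoothNear 𝕜 f a) :
    SmoothNear 𝕜 (_root_.fderiv 𝕜 f) a :=
  hf.mono fun _ hx => hx.fderiv_right (m := ∞) le_rfl

theorem norm_add_smul_le_two_mul {x v : E} {s : 𝕜} (hs : ‖s‖ ≤ 1) (hv : ‖v‖ ≤ ‖x‖) :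
    ‖x + s • v‖ ≤ 2 * ‖x‖ :=
  calc ‖x + s • v‖ ≤ ‖x‖ + ‖s‖ * ‖v‖ := (norm_add_le _ _).trans_eq (by rw [norm_smul])
    _ ≤ ‖x‖ + 1 * ‖x‖ := by gcongr
    _ = 2 * ‖x‖ := by ring

-- Markov's inequality, applied to the Taylor polynomials of `f` at `x` on the ball of radius `‖x‖`.
theorem SmoothNear.exists_norm_fderiv_apply_le {f : E → F} (hf : SmoothNear 𝕜 f 0) {n : ℕ}
    (h : f =O[𝓝 0] fun x => ‖x‖ ^ (n + 2)) :
    ∃ M, 0 ≤ M ∧ ∀ᶠ x in 𝓝 (0 : E), ∀ v, ‖v‖ ≤ ‖x‖ →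
      ‖_root_.fderiv 𝕜 f x v‖ ≤ M * ‖x‖ ^ (n + 2) := by
  obtain ⟨r₁, hr₁, C, hC⟩ := hf.exists_ball_norm_iteratedFDeriv_le (n + 2)
  obtain ⟨D, hD0, hD⟩ := h.exists_nonneg
  obtain ⟨r₂, hr₂, hD⟩ := Metric.eventually_nhds_iff_ball.1 hD.bound
  have hC0 : 0 ≤ C := (norm_nonneg _).trans (hC 0 (Metric.mem_ball_self hr₁)).2
  obtain ⟨M, hM0, hM⟩ := exists_norm_coeff_le (𝕜 := 𝕜) (F := F) (show 1 < n + 2 by omega)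
  refine ⟨M * (D * 2 ^ (n + 2) + C), by positivity, ?_⟩
  filter_upwards [Metric.ball_mem_nhds 0 (half_pos (lt_min hr₁ hr₂))] with x hx v hv
  have hnorm (s : 𝕜) (hs : s ∈ Metric.closedBall 0 1) : ‖x + s • v‖ ≤ 2 * ‖x‖ :=
    norm_add_smul_le_two_mul (by simpa using hs) hv
  have hmem : ∀ s ∈ Metric.closedBall (0 : 𝕜) 1, x + s • v ∈ Metric.ball 0 (min r₁ r₂) := by
    intro s hs
    rw [mem_ball_zero_iff] at hx ⊢
    linarith [hnorm s hs]
  have htaylor := norm_sub_sum_iteratedFDeriv_le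
    (fun s hs => (hC _ (Metric.ball_subset_ball (min_le_left _ _) (hmem s hs))).1)
    (fun s hs => (hC _ (Metric.ball_subset_ball (min_le_left _ _) (hmem s hs))).2)
  have hcoeff := hM (fun j => (j.factorial : 𝕜)⁻¹ • iteratedFDeriv 𝕜 j f x (fun _ => v))
    ((D * 2 ^ (n + 2) + C) * ‖x‖ ^ (n + 2)) fun s hs => by
    simp only [smul_smul]
    have hf : ‖f (x + s • v)‖ ≤ D * (2 * ‖x‖) ^ (n + 2) :=
      (hD _ (Metric.ball_subset_ball (min_le_right _ _) (hmem s hs))).trans <| by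
        rw [norm_pow, norm_norm]
        gcongr
        exact hnorm s hs
    calc _ ≤ C * ‖v‖ ^ (n + 2) + D * (2 * ‖x‖) ^ (n + 2) :=
          (norm_le_norm_sub_add _ _).trans <|
            add_le_add ((norm_sub_rev _ _).trans_le (htaylor s hs)) hf
      _ ≤ C * ‖x‖ ^ (n + 2) + D * (2 * ‖x‖) ^ (n + 2) := by gcongr
      _ = _ := by ring
  simpa [mul_assoc, iteratedFDeriv_one_apply] using hcoeff

theorem SmoothNear.fderiv_isBigO {f : E → F} (hf : SmoothNear 𝕜 f 0) {n : ℕ}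
    (h : f =O[𝓝 0] fun x => ‖x‖ ^ (n + 1)) :
    _root_.fderiv 𝕜 f =O[𝓝 0] fun x => ‖x‖ ^ n := by
  cases n with
  | zero => simpa using hf.fderiv.self_of_nhds.continuousAt.isBigO_one ℝ
  | succ n =>
    obtain ⟨M, hM0, hM⟩ := hf.exists_norm_fderiv_apply_le h
    refine IsBigO.of_bound M ?_
    filter_upwards [hM] with x hx
    rcases eq_or_ne x 0 with rfl | hx0
    · have h0 : HasFDerivAt f (0 : E →L[𝕜] F) 0 :=
        IsBigO.hasFDerivAt (n := n + 2) (by simpa using h) (by omega)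
      rw [h0.fderiv, norm_zero]
      positivity
    · have hx' : 0 < ‖x‖ := norm_pos_iff.2 hx0
      rw [norm_pow, norm_norm]
      refine ContinuousLinearMap.opNorm_le_of_unit_norm (by positivity) fun v hv =>
        le_of_mul_le_mul_left ?_ hx'
      calc ‖x‖ * ‖_root_.fderiv 𝕜 f x v‖ = ‖_root_.fderiv 𝕜 f x ((‖x‖ : 𝕜) • v)‖ := by
            simp [norm_smul]
        _ ≤ M * ‖x‖ ^ (n + 2) := hx _ (by simp [norm_smul, hv])
        _ = ‖x‖ * (M * ‖x‖ ^ (n + 1)) := by ring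

end Taylor

section Closure

variable {𝕜 : Type*} [RCLike 𝕜] {E F G : Type*} [NormedAddCommGroup E] [NormedSpace 𝕜 E]
  [NormedAddCommGroup F] [NormedSpace 𝕜 F] [NormedAddCommGroup G] [NormedSpace 𝕜 G]
  {f g : E → F} {a : E}

theorem SmoothNear.of_contDiff (hf : ContDiff 𝕜 ∞ f) : SmoothNear 𝕜 f a :=
  Eventually.of_forall fun _ => hf.contDiffAt

theorem SmoothNear.congr (hf : SmoothNear 𝕜 f a) (h : g =ᶠ[𝓝 a] f) : SmoothNear 𝕜 g a := by
  filter_upwards [hf, h.eventuallyEq_nhds] with x hfx hx using hfx.congr_of_eventuallyEq hx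

theorem SmoothNear.fun_add (hf : SmoothNear 𝕜 f a) (hg : SmoothNear 𝕜 g a) :
    SmoothNear 𝕜 (fun x => f x + g x) a := by
  filter_upwards [hf, hg] with x hfx hgx using hfx.add hgx

theorem SmoothNear.fun_sub (hf : SmoothNear 𝕜 f a) (hg : SmoothNear 𝕜 g a) :
    SmoothNear 𝕜 (fun x => f x - g x) a := by
  filter_upwards [hf, hg] with x hfx hgx using hfx.sub hgx

theorem SmoothNear.fun_mul {f g : E → 𝕜} (hf : SmoothNear 𝕜 f a) (hg : SmoothNear 𝕜 g a) :
    SmoothNear 𝕜 (fun x => f x * g x) a := by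
  filter_upwards [hf, hg] with x hfx hgx using hfx.mul hgx

theorem SmoothNear.fun_sum {ι : Type*} {s : Finset ι} {f : ι → E → F}
    (hf : ∀ i, SmoothNear 𝕜 (f i) a) : SmoothNear 𝕜 (fun x => ∑ i ∈ s, f i x) a := by
  filter_upwards [(Filter.eventually_all_finset s).2 fun i _ => hf i] with x hx
  exact ContDiffAt.sum hx

theorem SmoothNear.prodMk {g : E → G} (hf : SmoothNear 𝕜 f a) (hg : SmoothNear 𝕜 g a) :
    SmoothNear 𝕜 (fun x => (f x, g x)) a := by
  filter_upwards [hf, hg] with x hfx hgx using hfx.prodMk hgx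

theorem SmoothNear.clm_apply {c : E → F →L[𝕜] G} (hc : SmoothNear 𝕜 c a)
    (hf : SmoothNear 𝕜 f a) : SmoothNear 𝕜 (fun x => c x (f x)) a := by
  filter_upwards [hc, hf] with x hcx hfx using hcx.clm_apply hfx

theorem SmoothNear.comp {g : F → G} {b : F} (hg : SmoothNear 𝕜 g b) (hf : SmoothNear 𝕜 f a)
    (hb : f a = b) : SmoothNear 𝕜 (fun x => g (f x)) a := by
  subst hb
  filter_upwards [hf, hf.self_of_nhds.continuousAt.eventually hg] with x hfx hgx
  exact hgx.comp x hfx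

theorem smoothNear_pi {ι : Type*} [Fintype ι] {F : ι → Type*} [∀ i, NormedAddCommGroup (F i)]
    [∀ i, NormedSpace 𝕜 (F i)] {f : E → ∀ i, F i} :
    SmoothNear 𝕜 f a ↔ ∀ i, SmoothNear 𝕜 (fun x => f x i) a := by
  simp only [SmoothNear, contDiffAt_pi, eventually_all]

theorem SmoothNear.eventually_isInvertible_fderiv [CompleteSpace E] {Ψ : E → E}
    (hs : SmoothNear 𝕜 Ψ 0) (hd : HasFDerivAt Ψ (ContinuousLinearMap.id 𝕜 E) 0) :
    ∀ᶠ x in 𝓝 (0 : E), (_root_.fderiv 𝕜 Ψ x).IsInvertible := by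
  refine hs.fderiv.self_of_nhds.continuousAt.eventually ?_
  rw [hd.fderiv]
  exact (ContinuousLinearEquiv.refl 𝕜 E).nhds

theorem isDiffeoGerm_of_hasFDerivAt_id [CompleteSpace E] {Ψ : E → E} (h0 : Ψ 0 = 0)
    (hs : SmoothNear 𝕜 Ψ 0) (hd : HasFDerivAt Ψ (ContinuousLinearMap.id 𝕜 E) 0) :
    IsDiffeoGerm 𝕜 Ψ := by
  have hd' : HasFDerivAt Ψ ((ContinuousLinearEquiv.refl 𝕜 E : E ≃L[𝕜] E) : E →L[𝕜] E) 0 := hd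
  set e := hs.self_of_nhds.toOpenPartialHomeomorph Ψ hd' (by simp)
  have hsource : (0 : E) ∈ e.source :=
    hs.self_of_nhds.mem_toOpenPartialHomeomorph_source hd' (by simp)
  have htarget : (0 : E) ∈ e.target := h0 ▸ e.map_source hsource
  have hsymm0 : e.symm 0 = 0 := by
    simpa only [show e 0 = 0 from h0] using e.left_inv hsource
  have hsymm : Tendsto e.symm (𝓝 0) (𝓝 0) := by
    simpa only [ContinuousAt, hsymm0] using e.symm.continuousAt htarget
  refine ⟨h0, hs, e.symm, hsymm0, ?_, ?_, ?_⟩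
  · filter_upwards [hsymm.eventually hs, hsymm.eventually (hs.eventually_isInvertible_fderiv hd),
      e.open_target.mem_nhds htarget] with y hy ⟨f', hf'⟩ hmem
    refine e.contDiffAt_symm (f₀' := f') hmem ?_ hy
    rw [hf']
    exact (hy.differentiableAt (by simp)).hasFDerivAt
  · filter_upwards [e.open_source.mem_nhds hsource] with z hz using e.left_inv hz
  · filter_upwards [e.open_target.mem_nhds htarget] with z hz using e.right_inv hz

end Closure

section Germs

variable {𝕜 : Type*} [RCLike 𝕜] {p q : ℕ}

theorem Ep.exists_rep (φ : Ep 𝕜 p) : ∃ f, ∃ hf : SmoothNear 𝕜 f 0, φ = Ep.mk f hf := by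
  obtain ⟨_, f, hf, rfl⟩ := φ
  exact ⟨f, hf, rfl⟩

theorem Ep.mk_eq_mk {f g : (Fin p → 𝕜) → 𝕜} {hf : SmoothNear 𝕜 f 0} {hg : SmoothNear 𝕜 g 0} :
    Ep.mk f hf = Ep.mk g hg ↔ f =ᶠ[𝓝 0] g :=
  Subtype.ext_iff.trans Germ.coe_eq

theorem Ep.mk_congr {f g : (Fin p → 𝕜) → 𝕜} {hf : SmoothNear 𝕜 f 0} {hg : SmoothNear 𝕜 g 0}
    (h : ∀ x, f x = g x) : Ep.mk f hf = Ep.mk g hg :=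
  Ep.mk_eq_mk.2 (Eventually.of_forall h)

theorem Ep.mk_add {f g : (Fin p → 𝕜) → 𝕜} (hf : SmoothNear 𝕜 f 0) (hg : SmoothNear 𝕜 g 0) :
    Ep.mk f hf + Ep.mk g hg = Ep.mk (fun x => f x + g x) (hf.fun_add hg) := rfl

theorem Ep.mk_sub {f g : (Fin p → 𝕜) → 𝕜} (hf : SmoothNear 𝕜 f 0) (hg : SmoothNear 𝕜 g 0) :
    Ep.mk f hf - Ep.mk g hg = Ep.mk (fun x => f x - g x) (hf.fun_sub hg) := rfl

theorem Ep.mk_mul {f g : (Fin p → 𝕜) → 𝕜} (hf : SmoothNear 𝕜 f 0) (hg : SmoothNear 𝕜 g 0) :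
    Ep.mk f hf * Ep.mk g hg = Ep.mk (fun x => f x * g x) (hf.fun_mul hg) := rfl

theorem Ep.mk_sum {ι : Type*} {s : Finset ι} {f : ι → (Fin p → 𝕜) → 𝕜}
    (hf : ∀ i, SmoothNear 𝕜 (f i) 0) :
    ∑ i ∈ s, Ep.mk (f i) (hf i) = Ep.mk (fun x => ∑ i ∈ s, f i x) (.fun_sum hf) := by
  induction s using Finset.cons_induction with
  | empty => exact Ep.mk_congr (hf := .of_contDiff contDiff_const) fun _ => Finset.sum_empty.symm
  | cons i s hi ih =>
    rw [Finset.sum_cons, ih, Ep.mk_add]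
    exact Ep.mk_congr fun x => by rw [Finset.sum_cons]

/-- The constants, as germs in `ℰ_p`. -/
def Ep.const : 𝕜 →+* Ep 𝕜 p where
  toFun c := Ep.mk (fun _ => c) (.of_contDiff contDiff_const)
  map_one' := rfl
  map_zero' := rfl
  map_mul' _ _ := rfl
  map_add' _ _ := rfl

theorem Ep.const_mul_mk (c : 𝕜) {f : (Fin p → 𝕜) → 𝕜} (hf : SmoothNear 𝕜 f 0) :
    Ep.const c * Ep.mk f hf =
      Ep.mk (fun x => c * f x) ((SmoothNear.of_contDiff contDiff_const).fun_mul hf) := rfl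

theorem mk_mem_maxIdeal {f : (Fin p → 𝕜) → 𝕜} {hf : SmoothNear 𝕜 f 0} :
    Ep.mk f hf ∈ maxIdeal 𝕜 p ↔ f 0 = 0 :=
  Iff.rfl

/-- The ideal of germs that vanish to order `n` at `0`, i.e. that are `O(‖x‖ ^ n)`. It coincides
with `𝔪_p ^ n`, but is easier to recognise its elements. -/
def vanishIdeal (𝕜 : Type*) [RCLike 𝕜] (p n : ℕ) : Ideal (Ep 𝕜 p) where
  carrier := {φ | ∃ f, ∃ hf : SmoothNear 𝕜 f 0, φ = Ep.mk f hf ∧ f =O[𝓝 0] fun x => ‖x‖ ^ n}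
  add_mem' := by
    rintro _ _ ⟨f, hf, rfl, hfO⟩ ⟨g, hg, rfl, hgO⟩
    exact ⟨_, _, Ep.mk_add hf hg, hfO.add hgO⟩
  zero_mem' := ⟨fun _ => 0, .of_contDiff contDiff_const, rfl, isBigO_zero _ _⟩
  smul_mem' := by
    rintro c _ ⟨g, hg, rfl, hgO⟩
    obtain ⟨f, hf, rfl⟩ := c.exists_rep
    have hfO : f =O[𝓝 0] fun _ => (1 : ℝ) := hf.self_of_nhds.continuousAt.isBigO_one ℝ
    exact ⟨_, _, Ep.mk_mul hf hg, by simpa using hfO.mul hgO⟩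

theorem mk_mem_vanishIdeal {f : (Fin p → 𝕜) → 𝕜} {hf : SmoothNear 𝕜 f 0} {n : ℕ} :
    Ep.mk f hf ∈ vanishIdeal 𝕜 p n ↔ f =O[𝓝 0] fun x => ‖x‖ ^ n := by
  refine ⟨?_, fun h => ⟨f, hf, rfl, h⟩⟩
  rintro ⟨g, hg, hfg, hgO⟩
  exact hgO.congr' (Ep.mk_eq_mk.1 hfg).symm EventuallyEq.rfl

theorem vanishIdeal_anti {m n : ℕ} (h : m ≤ n) : vanishIdeal 𝕜 p n ≤ vanishIdeal 𝕜 p m := by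
  rintro _ ⟨f, hf, rfl, hfO⟩
  rcases h.eq_or_lt with rfl | h
  · exact mk_mem_vanishIdeal.2 hfO
  · exact mk_mem_vanishIdeal.2 (hfO.trans (isLittleO_norm_pow_norm_pow h).isBigO)

theorem mul_mem_vanishIdeal {m n : ℕ} {a b : Ep 𝕜 p} (ha : a ∈ vanishIdeal 𝕜 p m)
    (hb : b ∈ vanishIdeal 𝕜 p n) : a * b ∈ vanishIdeal 𝕜 p (m + n) := by
  obtain ⟨f, hf, rfl, hfO⟩ := ha
  obtain ⟨g, hg, rfl, hgO⟩ := hb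
  rw [Ep.mk_mul, mk_mem_vanishIdeal]
  simpa only [pow_add] using hfO.mul hgO

theorem vanishIdeal_zero : vanishIdeal 𝕜 p 0 = ⊤ := by
  refine (Ideal.eq_top_iff_one _).2 (mk_mem_vanishIdeal (hf := .of_contDiff contDiff_const).2 ?_)
  simpa using isBigO_refl (fun _ => (1 : 𝕜)) (𝓝 (0 : Fin p → 𝕜))

theorem vanishIdeal_one : vanishIdeal 𝕜 p 1 = maxIdeal 𝕜 p := by
  ext a
  obtain ⟨f, hf, rfl⟩ := a.exists_rep
  rw [mk_mem_vanishIdeal, mk_mem_maxIdeal]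
  refine ⟨fun h => ?_, fun h => ?_⟩
  · exact IsBigO.eq_zero_of_norm_pow (x₀ := 0) (n := 1) (by simpa using h) one_ne_zero
  · simpa [taylorSum, h] using hf.sub_taylorSum_isBigO 1

theorem maxIdeal_mul_vanishIdeal_le (n : ℕ) :
    maxIdeal 𝕜 p * vanishIdeal 𝕜 p n ≤ vanishIdeal 𝕜 p (n + 1) := by
  rw [← vanishIdeal_one, Ideal.mul_le, add_comm]
  exact fun a ha b hb => mul_mem_vanishIdeal ha hb

theorem maxIdeal_pow_le_vanishIdeal (n : ℕ) : maxIdeal 𝕜 p ^ n ≤ vanishIdeal 𝕜 p n := by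
  induction n with
  | zero => simp only [vanishIdeal_zero, le_top]
  | succ n ih =>
    rw [pow_succ']
    exact (Ideal.mul_mono_right ih).trans (maxIdeal_mul_vanishIdeal_le n)

theorem pderiv_mk (i : Fin p) {f : (Fin p → 𝕜) → 𝕜} (hf : SmoothNear 𝕜 f 0) :
    pderiv i (Ep.mk f hf) = Ep.mk (fun x => fderiv 𝕜 f x (Pi.single i 1))
      (hf.fderiv.clm_apply (.of_contDiff contDiff_const)) := rfl

theorem pderiv_add (i : Fin p) (a b : Ep 𝕜 p) : pderiv i (a + b) = pderiv i a + pderiv i b := by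
  obtain ⟨f, hf, rfl⟩ := a.exists_rep
  obtain ⟨g, hg, rfl⟩ := b.exists_rep
  rw [Ep.mk_add, pderiv_mk, pderiv_mk, pderiv_mk, Ep.mk_add, Ep.mk_eq_mk]
  filter_upwards [hf, hg] with x hfx hgx
  rw [fderiv_fun_add (hfx.differentiableAt (by simp)) (hgx.differentiableAt (by simp))]
  rfl

theorem pderiv_mul (i : Fin p) (a b : Ep 𝕜 p) :
    pderiv i (a * b) = a * pderiv i b + b * pderiv i a := by
  obtain ⟨f, hf, rfl⟩ := a.exists_rep
  obtain ⟨g, hg, rfl⟩ := b.exists_rep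
  rw [Ep.mk_mul, pderiv_mk, pderiv_mk, pderiv_mk, Ep.mk_mul, Ep.mk_mul, Ep.mk_add, Ep.mk_eq_mk]
  filter_upwards [hf, hg] with x hfx hgx
  rw [fderiv_fun_mul (hfx.differentiableAt (by simp)) (hgx.differentiableAt (by simp))]
  rfl

theorem pderiv_mem_vanishIdeal (i : Fin p) {a : Ep 𝕜 p} {n : ℕ}
    (ha : a ∈ vanishIdeal 𝕜 p (n + 1)) : pderiv i a ∈ vanishIdeal 𝕜 p n := by
  obtain ⟨f, hf, rfl, hfO⟩ := ha
  rw [pderiv_mk, mk_mem_vanishIdeal]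
  refine (IsBigO.of_bound ‖(Pi.single i 1 : Fin p → 𝕜)‖ ?_).trans (hf.fderiv_isBigO hfO)
  exact Eventually.of_forall fun x => (ContinuousLinearMap.le_opNorm _ _).trans_eq (mul_comm _ _)

/-- The derivation `a ↦ ∑ i, ξ_i ∂a/∂x_i` of `ℰ_p` given by a vector field germ `ξ`. -/
def fieldDer (ξ : Fin p → Ep 𝕜 p) : Derivation ℤ (Ep 𝕜 p) (Ep 𝕜 p) :=
  Derivation.mk' (AddMonoidHom.mk' (fun a => ∑ i, ξ i * pderiv i a) (fun a b => by
    simp only [pderiv_add, mul_add, Finset.sum_add_distrib])).toIntLinearMap (fun a b => by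
    simp only [AddMonoidHom.coe_toIntLinearMap, AddMonoidHom.mk'_apply, pderiv_mul, smul_eq_mul,
      Finset.mul_sum, ← Finset.sum_add_distrib]
    exact Finset.sum_congr rfl fun i _ => by ring)

theorem fieldDer_apply (ξ : Fin p → Ep 𝕜 p) (a : Ep 𝕜 p) :
    fieldDer ξ a = ∑ i, ξ i * pderiv i a := rfl

theorem fieldDer_mem_vanishIdeal {ξ : Fin p → Ep 𝕜 p} (hξ : ∀ i, ξ i ∈ vanishIdeal 𝕜 p 2)
    {a : Ep 𝕜 p} {n : ℕ} (ha : a ∈ vanishIdeal 𝕜 p n) :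
    fieldDer ξ a ∈ vanishIdeal 𝕜 p (n + 1) := by
  rw [fieldDer_apply]
  refine Ideal.sum_mem _ fun i _ => ?_
  cases n with
  | zero => exact vanishIdeal_anti one_le_two (Ideal.mul_mem_right _ _ (hξ i))
  | succ n =>
    rw [show n + 1 + 1 = 2 + n by omega]
    exact mul_mem_vanishIdeal (hξ i) (pderiv_mem_vanishIdeal i ha)

theorem fieldDer_iterate_mem_vanishIdeal {ξ : Fin p → Ep 𝕜 p}
    (hξ : ∀ i, ξ i ∈ vanishIdeal 𝕜 p 2) (a : Ep 𝕜 p) (n : ℕ) :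
    (fieldDer ξ)^[n] a ∈ vanishIdeal 𝕜 p n := by
  induction n with
  | zero => simp only [vanishIdeal_zero, Submodule.mem_top]
  | succ n ih =>
    rw [Function.iterate_succ_apply']
    exact fieldDer_mem_vanishIdeal hξ ih

theorem pullback_mk (h : MapGerm 𝕜 p q) {f : (Fin q → 𝕜) → 𝕜} (hf : SmoothNear 𝕜 f 0) :
    h.pullback (Ep.mk f hf) = Ep.mk (fun x => f (h.toFun x)) (hf.comp h.smooth' h.map_zero') :=
  rfl

theorem pullback_const (h : MapGerm 𝕜 p q) (c : 𝕜) : h.pullback (Ep.const c) = Ep.const c := rfl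

theorem pullback_mem_vanishIdeal (h : MapGerm 𝕜 p q) {a : Ep 𝕜 q} {n : ℕ}
    (ha : a ∈ vanishIdeal 𝕜 q n) : h.pullback a ∈ vanishIdeal 𝕜 p n := by
  obtain ⟨f, hf, rfl, hfO⟩ := ha
  have hO : h.toFun =O[𝓝 0] fun x => ‖x‖ := by
    simpa [taylorSum, h.map_zero'] using h.smooth'.sub_taylorSum_isBigO 1
  rw [pullback_mk, mk_mem_vanishIdeal]
  exact (hfO.comp_tendsto h.tendsto).trans (hO.norm_left.pow n)

/-- The components of the germ at `0` of a map, as an element of `ℰ_p ^ q`. -/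
def Ep.mkPi (f : (Fin p → 𝕜) → Fin q → 𝕜) (hf : SmoothNear 𝕜 f 0) (j : Fin q) : Ep 𝕜 p :=
  Ep.mk (fun x => f x j) (smoothNear_pi.1 hf j)

theorem comps_eq_mkPi (h : MapGerm 𝕜 p q) : h.comps = Ep.mkPi h.toFun h.smooth' := rfl

theorem Ep.mkPi_mem_vanishIdeal {f : (Fin p → 𝕜) → Fin q → 𝕜} {hf : SmoothNear 𝕜 f 0} {n : ℕ} :
    (∀ j, Ep.mkPi f hf j ∈ vanishIdeal 𝕜 p n) ↔ f =O[𝓝 0] fun x => ‖x‖ ^ n :=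
  (forall_congr' fun _ => mk_mem_vanishIdeal).trans isBigO_pi.symm

/-- The derivative of the function `f` along the vector field `X`. -/
def dirDeriv (X : (Fin p → 𝕜) → Fin p → 𝕜) (f : (Fin p → 𝕜) → 𝕜) (x : Fin p → 𝕜) : 𝕜 :=
  fderiv 𝕜 f x (X x)

theorem SmoothNear.dirDeriv_iterate {X : (Fin p → 𝕜) → Fin p → 𝕜} (hX : SmoothNear 𝕜 X 0)
    {f : (Fin p → 𝕜) → 𝕜} (hf : SmoothNear 𝕜 f 0) (n : ℕ) :
    SmoothNear 𝕜 ((dirDeriv X)^[n] f) 0 := by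
  induction n with
  | zero => exact hf
  | succ n ih =>
    rw [Function.iterate_succ_apply']
    exact ih.fderiv.clm_apply hX

theorem fieldDer_mkPi_mk {X : (Fin p → 𝕜) → Fin p → 𝕜} (hX : SmoothNear 𝕜 X 0)
    {f : (Fin p → 𝕜) → 𝕜} (hf : SmoothNear 𝕜 f 0) :
    fieldDer (Ep.mkPi X hX) (Ep.mk f hf) = Ep.mk (dirDeriv X f) (hX.dirDeriv_iterate hf 1) := by
  simp only [fieldDer_apply, Ep.mkPi, pderiv_mk, Ep.mk_mul, Ep.mk_sum]
  refine Ep.mk_congr fun x => ?_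
  rw [dirDeriv]
  conv_rhs => rw [pi_eq_sum_univ' (X x), map_sum]
  simp only [map_smul, smul_eq_mul]

theorem fieldDer_mkPi_iterate_mk {X : (Fin p → 𝕜) → Fin p → 𝕜} (hX : SmoothNear 𝕜 X 0)
    {f : (Fin p → 𝕜) → 𝕜} (hf : SmoothNear 𝕜 f 0) (n : ℕ) :
    (fieldDer (Ep.mkPi X hX))^[n] (Ep.mk f hf) =
      Ep.mk ((dirDeriv X)^[n] f) (hX.dirDeriv_iterate hf n) := by
  induction n with
  | zero => rfl
  | succ n ih =>
    rw [Function.iterate_succ_apply', ih, fieldDer_mkPi_mk]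
    exact Ep.mk_congr fun x => by rw [Function.iterate_succ_apply']

end Germs

section Flow

variable {𝕜 : Type*} [RCLike 𝕜] {E : Type*} [NormedAddCommGroup E] [NormedSpace 𝕜 E]
  {Φ : 𝕜 × E → E} {X : E → E}

theorem fderiv_fderiv_time_space_eq_zero (hΦ : SmoothNear 𝕜 Φ (0, 0))
    (hjet : ∀ᶠ t in 𝓝 (0 : 𝕜), HasFDerivAt (fun x => Φ (t, x)) (ContinuousLinearMap.id 𝕜 E) 0)
    (v : E) : fderiv 𝕜 (fderiv 𝕜 Φ) (0, 0) (1, 0) (0, v) = 0 := by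
  have htime : HasDerivAt (fun t : 𝕜 => (t, (0 : E))) (1, 0) 0 :=
    (hasDerivAt_id 0).prodMk (hasDerivAt_const _ _)
  have hder : HasDerivAt (fun t : 𝕜 => fderiv 𝕜 Φ (t, 0) (0, v))
      (fderiv 𝕜 (fderiv 𝕜 Φ) (0, 0) (1, 0) (0, v)) 0 :=
    (ContinuousLinearMap.apply 𝕜 E ((0 : 𝕜), v)).hasFDerivAt.comp_hasDerivAt (0 : 𝕜)
      (((hΦ.fderiv.self_of_nhds.differentiableAt (by simp)).hasFDerivAt).comp_hasDerivAt
        (0 : 𝕜) htime)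
  have hspace : ∀ᶠ t in 𝓝 (0 : 𝕜), fderiv 𝕜 Φ (t, 0) (0, v) = v := by
    filter_upwards [hjet, htime.continuousAt.eventually hΦ] with t ht hΦt
    have hx := (hΦt.differentiableAt (by simp)).hasFDerivAt.comp (0 : E)
      (hasFDerivAt_prodMk_right t 0)
    simpa using DFunLike.congr_fun (hx.unique ht) v
  exact hder.unique ((hasDerivAt_const (0 : 𝕜) v).congr_of_eventuallyEq hspace)

theorem hasFDerivAt_zero_of_flow (hΦ : SmoothNear 𝕜 Φ (0, 0))
    (hode : ∀ᶠ x in 𝓝 (0 : E), HasDerivAt (fun t => Φ (t, x)) (X x) 0)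
    (hjet : ∀ᶠ t in 𝓝 (0 : 𝕜), HasFDerivAt (fun x => Φ (t, x)) (ContinuousLinearMap.id 𝕜 E) 0) :
    HasFDerivAt X (0 : E →L[𝕜] E) 0 := by
  have hspace : HasFDerivAt (fun x : E => ((0 : 𝕜), x)) (ContinuousLinearMap.inr 𝕜 𝕜 E) 0 :=
    hasFDerivAt_prodMk_right 0 0
  have hX : X =ᶠ[𝓝 0] fun x => fderiv 𝕜 Φ (0, x) (1, 0) := by
    filter_upwards [hode, hspace.continuousAt.eventually hΦ] with x hx hΦx
    exact hx.unique ((hΦx.differentiableAt (by simp)).hasFDerivAt.comp_hasDerivAt (0 : 𝕜)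
      ((hasDerivAt_id 0).prodMk (hasDerivAt_const _ _)))
  have hder : HasFDerivAt (fun x : E => fderiv 𝕜 Φ (0, x) (1, 0))
      ((ContinuousLinearMap.apply 𝕜 E ((1 : 𝕜), (0 : E))).comp
        ((fderiv 𝕜 (fderiv 𝕜 Φ) (0, 0)).comp (ContinuousLinearMap.inr 𝕜 𝕜 E))) 0 :=
    (ContinuousLinearMap.apply 𝕜 E ((1 : 𝕜), (0 : E))).hasFDerivAt.comp (0 : E)
      ((hΦ.fderiv.self_of_nhds.differentiableAt (by simp)).hasFDerivAt.comp (0 : E) hspace)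
  have hsymm : IsSymmSndFDerivAt 𝕜 Φ (0, 0) := hΦ.self_of_nhds.isSymmSndFDerivAt (by
    rw [minSmoothness_of_isRCLikeNormedField]
    exact WithTop.coe_le_coe.2 (le_top : (2 : ℕ∞) ≤ ⊤))
  refine (hder.congr_of_eventuallyEq hX).congr_fderiv (ContinuousLinearMap.ext fun v => ?_)
  exact (hsymm _ _).trans (fderiv_fderiv_time_space_eq_zero hΦ hjet v)

end Flow

section UniformFlow

variable {𝕜 : Type*} [RCLike 𝕜] {p : ℕ}

/-- A local flow `Φ` of the vector field `X` with the properties that define `Θ_{V,1}`, holding on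
the product of two balls of one radius `δ`, together with a linear bound that is uniform in time. -/
structure IsUniformFlow (V : Set (Fin p → 𝕜)) (X : (Fin p → 𝕜) → Fin p → 𝕜)
    (Φ : 𝕜 × (Fin p → 𝕜) → Fin p → 𝕜) (δ : ℝ) (C : NNReal) : Prop where
  pos : 0 < δ
  smoothNear_field : SmoothNear 𝕜 X 0
  initial : ∀ x, ‖x‖ < δ → Φ (0, x) = x
  smooth : ∀ t x, ‖t‖ < δ → ‖x‖ < δ → ContDiffAt 𝕜 ∞ Φ (t, x)
  ode : ∀ t x, ‖t‖ < δ → ‖x‖ < δ → HasDerivAt (fun s => Φ (s, x)) (X (Φ (t, x))) t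
  bound : ∀ t x, ‖t‖ < δ → ‖x‖ < δ → ‖Φ (t, x)‖ ≤ C * ‖x‖
  preserves : ∀ t x, ‖t‖ < δ → ‖x‖ < δ → (x ∈ V ↔ Φ (t, x) ∈ V)
  oneJet : ∀ t, ‖t‖ < δ → HasOneJetId fun x => Φ (t, x)

theorem IsLocalFlow.exists_field {ξ : Fin p → Ep 𝕜 p} {Φ : 𝕜 × (Fin p → 𝕜) → Fin p → 𝕜}
    (hΦ : IsLocalFlow ξ Φ) : ∃ X, ∃ hX : SmoothNear 𝕜 X 0, ξ = Ep.mkPi X hX ∧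
      ∀ᶠ z in 𝓝 (0 : 𝕜 × (Fin p → 𝕜)), HasDerivAt (fun t => Φ (t, z.2)) (X (Φ z)) z.1 := by
  obtain ⟨X, hX, hode⟩ := hΦ.ode
  refine ⟨X, smoothNear_pi.2 fun i => ?_, funext fun i => Subtype.ext (hX i), hode⟩
  obtain ⟨f, hf, hξf⟩ := (ξ i).2
  exact hf.congr (Germ.coe_eq.1 ((hX i).symm.trans hξf))

theorem exists_isUniformFlow {V : Set (Fin p → 𝕜)} {ξ : Fin p → Ep 𝕜 p} (hξ : ξ ∈ Theta1 V) :
    ∃ X, ∃ hX : SmoothNear 𝕜 X 0, ξ = Ep.mkPi X hX ∧ ∃ Φ δ C, IsUniformFlow V X Φ δ C := by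
  obtain ⟨Φ, hΦ, hV, hjet⟩ := hξ
  obtain ⟨X, hX, rfl, hode⟩ := hΦ.exists_field
  obtain ⟨C, s, hs, hC⟩ := (hΦ.smooth.self_of_nhds.of_le
    (by exact_mod_cast le_top : (1 : ℕ∞ω) ≤ ∞)).exists_lipschitzOnWith
  obtain ⟨δ, hδ, hball⟩ := Metric.eventually_nhds_iff_ball.1
    ((hΦ.smooth.and (hode.and (hV.and hs))).and ((hjet.prod_inl_nhds 0).and
      (hΦ.initial.prod_inr_nhds 0)))
  have hmem {t : 𝕜} {x : Fin p → 𝕜} (ht : ‖t‖ < δ) (hx : ‖x‖ < δ) :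
      (t, x) ∈ Metric.ball (0 : 𝕜 × (Fin p → 𝕜)) δ := by simpa [Prod.norm_def] using ⟨ht, hx⟩
  have h𝕜 : ‖(0 : 𝕜)‖ < δ := by simpa using hδ
  have hE : ‖(0 : Fin p → 𝕜)‖ < δ := by simpa using hδ
  refine ⟨X, hX, rfl, Φ, δ, C, ⟨hδ, hX,
    fun x hx => (hball _ (hmem h𝕜 hx)).2.2,
    fun t x ht hx => (hball _ (hmem ht hx)).1.1,
    fun t x ht hx => (hball _ (hmem ht hx)).1.2.1, fun t x ht hx => ?_,
    fun t x ht hx => (hball _ (hmem ht hx)).1.2.2.1,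
    fun t ht => (hball _ (hmem ht hE)).2.1⟩⟩
  have hΦ0 : Φ (t, 0) = 0 := (hball _ (hmem ht hE)).2.1.1
  simpa [hΦ0, Prod.norm_def] using
    hC.norm_sub_le (hball _ (hmem ht hx)).1.2.2.2 (hball _ (hmem ht hE)).1.2.2.2

namespace IsUniformFlow

variable {V : Set (Fin p → 𝕜)} {X : (Fin p → 𝕜) → Fin p → 𝕜}
  {Φ : 𝕜 × (Fin p → 𝕜) → Fin p → 𝕜} {δ : ℝ} {C : NNReal}

theorem eventually_norm_lt {E : Type*} [NormedAddCommGroup E] (H : IsUniformFlow V X Φ δ C) :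
    ∀ᶠ x : E in 𝓝 0, ‖x‖ < δ :=
  tendsto_norm_zero.eventually_lt_const H.pos

theorem smoothNear (H : IsUniformFlow V X Φ δ C) : SmoothNear 𝕜 Φ (0, 0) := by
  rw [SmoothNear, nhds_prod_eq]
  filter_upwards [(H.eventually_norm_lt (E := 𝕜)).prod_mk H.eventually_norm_lt] with z hz
  exact H.smooth z.1 z.2 hz.1 hz.2

theorem field_isBigO (H : IsUniformFlow V X Φ δ C) : X =O[𝓝 0] fun x => ‖x‖ ^ 2 := by
  have h𝕜 : ‖(0 : 𝕜)‖ < δ := by simpa using H.pos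
  have hE : ‖(0 : Fin p → 𝕜)‖ < δ := by simpa using H.pos
  have hode : ∀ x, ‖x‖ < δ → HasDerivAt (fun t => Φ (t, x)) (X x) 0 := fun x hx => by
    simpa only [H.initial x hx] using H.ode 0 x h𝕜 hx
  have hX0 : X 0 = 0 := by
    refine (hode 0 hE).unique ((hasDerivAt_const (0 : 𝕜) (0 : Fin p → 𝕜)).congr_of_eventuallyEq ?_)
    filter_upwards [H.eventually_norm_lt] with t ht using (H.oneJet t ht).1
  have hX' : HasFDerivAt X (0 : (Fin p → 𝕜) →L[𝕜] (Fin p → 𝕜)) 0 :=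
    hasFDerivAt_zero_of_flow H.smoothNear (H.eventually_norm_lt.mono hode)
      (H.eventually_norm_lt.mono fun t ht => (H.oneJet t ht).2)
  simpa [taylorSum, Finset.sum_range_succ, hX0, hX'.fderiv] using
    H.smoothNear_field.sub_taylorSum_isBigO 2

/-- The time-`t` map of the flow. -/
def timeMap (H : IsUniformFlow V X Φ δ C) {t : 𝕜} (ht : ‖t‖ < δ) : MapGerm 𝕜 p p where
  toFun x := Φ (t, x)
  smooth' := by
    filter_upwards [H.eventually_norm_lt] with x hx
    exact (H.smooth t x ht hx).comp x (contDiffAt_const.prodMk contDiffAt_id)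
  map_zero' := (H.oneJet t ht).1

theorem comp_sub_sum_isBigO (H : IsUniformFlow V X Φ δ C) {t : 𝕜} (ht : ‖t‖ < δ)
    {f : (Fin p → 𝕜) → 𝕜} (hf : SmoothNear 𝕜 f 0) {K m : ℕ}
    (hO : (dirDeriv X)^[K] f =O[𝓝 0] fun x => ‖x‖ ^ m) :
    (fun x => f (Φ (t, x)) -
      ∑ n ∈ Finset.range K, t ^ n * (n.factorial : 𝕜)⁻¹ * (dirDeriv X)^[n] f x) =O[𝓝 0]
        fun x => ‖x‖ ^ m := by
  obtain ⟨M, hM0, hM⟩ := hO.exists_pos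
  obtain ⟨r, hr, hball⟩ := Metric.eventually_nhds_iff_ball.1
    (((Filter.eventually_all_finset (Finset.range K)).2 fun n _ =>
      H.smoothNear_field.dirDeriv_iterate hf n).and hM.bound)
  have hlt : ∀ᶠ x in 𝓝 (0 : Fin p → 𝕜), C * ‖x‖ < r :=
    (continuous_const.mul continuous_norm).continuousAt.eventually_lt_const (by simpa using hr)
  refine IsBigO.of_bound (M * C ^ m * ‖t‖ ^ K) ?_
  filter_upwards [hlt, H.eventually_norm_lt] with x hxr hxδ
  have hsδ {s : 𝕜} (hs : s ∈ Metric.closedBall (0 : 𝕜) ‖t‖) : ‖s‖ < δ :=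
    (mem_closedBall_zero_iff.1 hs).trans_lt ht
  have hmem {s : 𝕜} (hs : s ∈ Metric.closedBall (0 : 𝕜) ‖t‖) :
      Φ (s, x) ∈ Metric.ball (0 : Fin p → 𝕜) r :=
    mem_ball_zero_iff.2 ((H.bound s x (hsδ hs) hxδ).trans_lt hxr)
  have hder : ∀ n < K, ∀ s ∈ Metric.closedBall (0 : 𝕜) ‖t‖, HasDerivAt
      (fun s => (dirDeriv X)^[n] f (Φ (s, x))) ((dirDeriv X)^[n + 1] f (Φ (s, x))) s := by
    intro n hn s hs
    have hn := ((hball _ (hmem hs)).1 n (Finset.mem_range.2 hn)).differentiableAt (by simp)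
    rw [Function.iterate_succ_apply']
    exact hn.hasFDerivAt.comp_hasDerivAt s (H.ode s x (hsδ hs) hxδ)
  have hlast : ∀ s ∈ Metric.closedBall (0 : 𝕜) ‖t‖,
      ‖(dirDeriv X)^[K] f (Φ (s, x))‖ ≤ M * (C * ‖x‖) ^ m := by
    intro s hs
    refine (hball _ (hmem hs)).2.trans ?_
    rw [norm_pow, norm_norm]
    gcongr
    exact H.bound s x (hsδ hs) hxδ
  have htaylor := norm_sub_sum_le_of_hasDerivAt
    (u := fun n s => (dirDeriv X)^[n] f (Φ (s, x))) hder hlast t (by simp)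
  simp only [Function.iterate_zero, id_eq, H.initial x hxδ, smul_eq_mul] at htaylor
  refine htaylor.trans_eq ?_
  rw [norm_pow, norm_norm]
  ring

theorem pullback_timeMap_sub_sum_mem (H : IsUniformFlow V X Φ δ C) {t : 𝕜} (ht : ‖t‖ < δ)
    (a : Ep 𝕜 p) (m : ℕ) :
    (H.timeMap ht).pullback a - ∑ n ∈ Finset.range m, Ep.const (t ^ n * (n.factorial : 𝕜)⁻¹) *
      (fieldDer (Ep.mkPi X H.smoothNear_field))^[n] a ∈ vanishIdeal 𝕜 p m := by
  obtain ⟨f, hf, rfl⟩ := a.exists_rep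
  have hO : (dirDeriv X)^[m] f =O[𝓝 0] fun x => ‖x‖ ^ m := by
    have hmem := fieldDer_iterate_mem_vanishIdeal
      ((Ep.mkPi_mem_vanishIdeal (hf := H.smoothNear_field)).2 H.field_isBigO) (Ep.mk f hf) m
    rwa [fieldDer_mkPi_iterate_mk, mk_mem_vanishIdeal] at hmem
  simp only [fieldDer_mkPi_iterate_mk, Ep.const_mul_mk, Ep.mk_sum fun n =>
    (SmoothNear.of_contDiff contDiff_const).fun_mul (H.smoothNear_field.dirDeriv_iterate hf n)]
  rw [pullback_mk, Ep.mk_sub, mk_mem_vanishIdeal]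
  exact H.comp_sub_sum_isBigO ht hf hO

end IsUniformFlow

end UniformFlow

section Equivalences

variable {𝕜 : Type*} [RCLike 𝕜] {p q : ℕ} {V : Set (Fin p → 𝕜)}

theorem HasOneJetId.comp {ψ₁ ψ₂ : (Fin p → 𝕜) → Fin p → 𝕜} (h₂ : HasOneJetId ψ₂)
    (h₁ : HasOneJetId ψ₁) : HasOneJetId fun x => ψ₂ (ψ₁ x) :=
  ⟨(congr_arg ψ₂ h₁.1).trans h₂.1, HasFDerivAt.comp (g := ψ₂)
    (g' := ContinuousLinearMap.id 𝕜 (Fin p → 𝕜)) (0 : Fin p → 𝕜) (by rw [h₁.1]; exact h₂.2) h₁.2⟩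

theorem MapsGermOnto.comp {E : Type*} [NormedAddCommGroup E] {ψ₁ ψ₂ : E → E} {A B D : Set E}
    (h₂ : MapsGermOnto ψ₂ B D) (h₁ : MapsGermOnto ψ₁ A B) (ht : Tendsto ψ₁ (𝓝 0) (𝓝 0)) :
    MapsGermOnto (fun z => ψ₂ (ψ₁ z)) A D := by
  filter_upwards [h₁, ht.eventually h₂] with z hz₁ hz₂ using hz₁.trans hz₂

/-- The composition of two map germs. -/
def MapGerm.comp (ψ₂ ψ₁ : MapGerm 𝕜 p p) : MapGerm 𝕜 p p where
  toFun x := ψ₂.toFun (ψ₁.toFun x)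
  smooth' := ψ₂.smooth'.comp ψ₁.smooth' ψ₁.map_zero'
  map_zero' := by rw [ψ₁.map_zero', ψ₂.map_zero']

theorem pullback_comp (ψ₂ ψ₁ : MapGerm 𝕜 p p) (a : Ep 𝕜 p) :
    (ψ₂.comp ψ₁).pullback a = ψ₁.pullback (ψ₂.pullback a) := by
  obtain ⟨f, hf, rfl⟩ := a.exists_rep
  rfl

/-- `ψ` is a germ as required of the base map of a `_V𝒦_1`-equivalence, and modulo the ideal `N` it
acts on functions like the flow of the derivation `D` after time `c`, to first order. -/
structure IsFlowMapMod (V : Set (Fin p → 𝕜)) (D : Derivation ℤ (Ep 𝕜 p) (Ep 𝕜 p))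
    (N : Ideal (Ep 𝕜 p)) (c : 𝕜) (ψ : MapGerm 𝕜 p p) : Prop where
  oneJet : HasOneJetId ψ.toFun
  preserves : MapsGermOnto ψ.toFun V V
  pullback_sub_mem : ∀ a, D (D a) ∈ N → ψ.pullback a - (a + Ep.const c * D a) ∈ N

theorem IsFlowMapMod.comp {D : Derivation ℤ (Ep 𝕜 p) (Ep 𝕜 p)} {N : Ideal (Ep 𝕜 p)}
    {c₁ c₂ : 𝕜} {ψ₁ ψ₂ : MapGerm 𝕜 p p} (hD : ∀ a ∈ N, D a ∈ N) (h₂ : IsFlowMapMod V D N c₂ ψ₂)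
    (h₁ : IsFlowMapMod V D N c₁ ψ₁) : IsFlowMapMod V D N (c₁ + c₂) (ψ₂.comp ψ₁) where
  oneJet := h₂.oneJet.comp h₁.oneJet
  preserves := h₂.preserves.comp h₁.preserves ψ₁.tendsto
  pullback_sub_mem a ha := by
    have hmaps {b : Ep 𝕜 p} (hb : b ∈ N) : ψ₁.pullback b ∈ N := by
      have hDb : b + Ep.const c₁ * D b ∈ N := add_mem hb (Ideal.mul_mem_left _ _ (hD b hb))
      exact (Submodule.sub_mem_iff_left _ hDb).1 (h₁.pullback_sub_mem b (hD _ (hD b hb)))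
    have hsum := add_mem (add_mem (hmaps (h₂.pullback_sub_mem a ha)) (h₁.pullback_sub_mem a ha))
      (Ideal.mul_mem_left _ (Ep.const c₂)
        (add_mem (h₁.pullback_sub_mem (D a) (hD _ ha)) (Ideal.mul_mem_left _ (Ep.const c₁) ha)))
    convert hsum using 1
    simp only [pullback_comp, map_sub, map_add, map_mul, pullback_const]
    ring

theorem IsFlowMapMod.exists_nat_mul {D : Derivation ℤ (Ep 𝕜 p) (Ep 𝕜 p)} {N : Ideal (Ep 𝕜 p)}
    {c : 𝕜} {ψ : MapGerm 𝕜 p p} (hD : ∀ a ∈ N, D a ∈ N) (h : IsFlowMapMod V D N c ψ) (n : ℕ) :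
    ∃ φ, IsFlowMapMod V D N ((n + 1) * c) φ := by
  induction n with
  | zero => exact ⟨ψ, by simpa using h⟩
  | succ n ih =>
    obtain ⟨φ, hφ⟩ := ih
    exact ⟨φ.comp ψ, by convert hφ.comp hD h using 1; push_cast; ring⟩

theorem IsUniformFlow.isFlowMapMod_timeMap {X : (Fin p → 𝕜) → Fin p → 𝕜}
    {Φ : 𝕜 × (Fin p → 𝕜) → Fin p → 𝕜} {δ : ℝ} {C : NNReal} (H : IsUniformFlow V X Φ δ C) {t : 𝕜}
    (ht : ‖t‖ < δ) {N : Ideal (Ep 𝕜 p)} {m : ℕ} (hN : vanishIdeal 𝕜 p m ≤ N)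
    (hD : ∀ a ∈ N, fieldDer (Ep.mkPi X H.smoothNear_field) a ∈ N) :
    IsFlowMapMod V (fieldDer (Ep.mkPi X H.smoothNear_field)) N t (H.timeMap ht) where
  oneJet := H.oneJet t ht
  preserves := H.eventually_norm_lt.mono fun x hx => H.preserves t x ht hx
  pullback_sub_mem a ha := by
    have hiter (n : ℕ) : (fieldDer (Ep.mkPi X H.smoothNear_field))^[n + 2] a ∈ N := by
      induction n with
      | zero => exact ha
      | succ n ih =>
        rw [Function.iterate_succ_apply']
        exact hD _ ih
    have htaylor := hN (vanishIdeal_anti (Nat.le_add_right m 2)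
      (H.pullback_timeMap_sub_sum_mem ht a (m + 2)))
    rw [Finset.sum_range_succ', Finset.sum_range_succ'] at htaylor
    have hsum := add_mem htaylor (Ideal.sum_mem N fun n (_ : n ∈ Finset.range m) =>
      Ideal.mul_mem_left _ (Ep.const (t ^ (n + 2) * ((n + 2).factorial : 𝕜)⁻¹)) (hiter n))
    convert hsum using 1
    simp only [zero_add, pow_one, pow_zero, Nat.factorial, Nat.cast_one, inv_one, mul_one, map_one,
      one_mul, Function.iterate_succ, Function.iterate_zero, Function.comp_apply, id_eq]
    ring

theorem exists_isFlowMapMod_one {ξ : Fin p → Ep 𝕜 p} (hξ : ξ ∈ Theta1 V) {N : Ideal (Ep 𝕜 p)}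
    {m : ℕ} (hN : vanishIdeal 𝕜 p m ≤ N) (hD : ∀ a ∈ N, fieldDer ξ a ∈ N) :
    ∃ ψ, IsFlowMapMod V (fieldDer ξ) N 1 ψ := by
  obtain ⟨X, hX, rfl, Φ, δ, C, H⟩ := exists_isUniformFlow hξ
  obtain ⟨n, hn⟩ := exists_nat_one_div_lt H.pos
  have hn0 : (n : 𝕜) + 1 ≠ 0 := by exact_mod_cast n.succ_ne_zero
  have ht : ‖((n : 𝕜) + 1)⁻¹‖ < δ := by
    rw [norm_inv, ← Nat.cast_succ, RCLike.norm_natCast, ← one_div]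
    exact_mod_cast hn
  simpa [hn0] using (H.isFlowMapMod_timeMap ht hN hD).exists_nat_mul hD n

theorem mem_vanishIdeal_of_pullback {ψ : MapGerm 𝕜 p p} (hψ : HasOneJetId ψ.toFun)
    {a : Ep 𝕜 p} {n : ℕ} (ha : ψ.pullback a ∈ vanishIdeal 𝕜 p n) : a ∈ vanishIdeal 𝕜 p n := by
  obtain ⟨-, -, χ, hχ0, hχ, -, hψχ⟩ := isDiffeoGerm_of_hasFDerivAt_id hψ.1 ψ.smooth' hψ.2
  obtain ⟨f, hf, rfl⟩ := a.exists_rep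
  have hmem := pullback_mem_vanishIdeal ⟨χ, hχ, hχ0⟩ ha
  rw [pullback_mk, pullback_mk, mk_mem_vanishIdeal] at hmem
  rw [mk_mem_vanishIdeal]
  exact hmem.congr' (hψχ.mono fun x hx => congr_arg f hx) .rfl

/-- The map germ of `𝕜^p × 𝕜^q` that covers `ψ` and is linear on the fibres. -/
def fiberwiseLinear (ψ : (Fin p → 𝕜) → Fin p → 𝕜)
    (M : (Fin p → 𝕜) → (Fin q → 𝕜) →L[𝕜] (Fin q → 𝕜)) (z : (Fin p → 𝕜) × (Fin q → 𝕜)) :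
    (Fin p → 𝕜) × (Fin q → 𝕜) :=
  (ψ z.1, M z.1 z.2)

theorem isDiffeoGerm_fiberwiseLinear {ψ : MapGerm 𝕜 p p} (hψ : HasOneJetId ψ.toFun)
    {M : (Fin p → 𝕜) → (Fin q → 𝕜) →L[𝕜] (Fin q → 𝕜)} (hM : SmoothNear 𝕜 M 0)
    (hM0 : M 0 = .id 𝕜 (Fin q → 𝕜)) : IsDiffeoGerm 𝕜 (fiberwiseLinear ψ.toFun M) := by
  have hfst : SmoothNear 𝕜 (fun z : (Fin p → 𝕜) × (Fin q → 𝕜) => z.1) 0 := .of_contDiff contDiff_fst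
  have hMfst := hM.comp hfst rfl
  refine isDiffeoGerm_of_hasFDerivAt_id (Prod.ext hψ.1 (map_zero _))
    ((ψ.smooth'.comp hfst rfl).prodMk (hMfst.clm_apply (.of_contDiff contDiff_snd))) ?_
  have hbase : HasFDerivAt (fun z : (Fin p → 𝕜) × (Fin q → 𝕜) => ψ.toFun z.1) (.fst 𝕜 _ _) 0 :=
    HasFDerivAt.comp (g := ψ.toFun) (g' := .id 𝕜 (Fin p → 𝕜)) (0 : (Fin p → 𝕜) × (Fin q → 𝕜))
      hψ.2 hasFDerivAt_fst
  have hfiber : HasFDerivAt (fun z : (Fin p → 𝕜) × (Fin q → 𝕜) => M z.1 z.2) (.snd 𝕜 _ _) 0 := by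
    refine ((hMfst.self_of_nhds.differentiableAt (by simp)).hasFDerivAt.clm_apply
      hasFDerivAt_snd).congr_fderiv ?_
    simp [hM0]
  exact hbase.prodMk hfiber

theorem exists_vk1Equiv_of_fiberwiseLinear {ψ : MapGerm 𝕜 p p} (hψ : HasOneJetId ψ.toFun)
    (hψV : MapsGermOnto ψ.toFun V V) {M : (Fin p → 𝕜) → (Fin q → 𝕜) →L[𝕜] (Fin q → 𝕜)}
    (hM : SmoothNear 𝕜 M 0) (hM0 : M 0 = .id 𝕜 (Fin q → 𝕜)) (g : MapGerm 𝕜 p q) :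
    ∃ f : MapGerm 𝕜 p q, VK1Equiv V g f ∧
      ∀ᶠ x in 𝓝 0, f.toFun (ψ.toFun x) = M x (g.toFun x) := by
  obtain ⟨-, -, χ, hχ0, hχ, hχψ, -⟩ := isDiffeoGerm_of_hasFDerivAt_id hψ.1 ψ.smooth' hψ.2
  have hinj : ∀ᶠ x in 𝓝 (0 : Fin p → 𝕜), Function.Injective (M x) := by
    have hnhds : Set.range ((↑) : ((Fin q → 𝕜) ≃L[𝕜] (Fin q → 𝕜)) → _) ∈ 𝓝 (M 0) := by
      rw [hM0]
      exact (ContinuousLinearEquiv.refl 𝕜 _).nhds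
    filter_upwards [hM.self_of_nhds.continuousAt.eventually hnhds] with x ⟨e, he⟩
    rw [← he]
    exact e.injective
  let f : MapGerm 𝕜 p q :=
    { toFun := fun x => M (χ x) (g.toFun (χ x))
      smooth' := (hM.clm_apply g.smooth').comp hχ hχ0
      map_zero' := by rw [hχ0, g.map_zero', map_zero] }
  have hfst : Tendsto (Prod.fst : (Fin p → 𝕜) × (Fin q → 𝕜) → _) (𝓝 0) (𝓝 0) :=
    continuous_fst.tendsto 0
  refine ⟨f, ⟨fiberwiseLinear ψ.toFun M, ⟨isDiffeoGerm_fiberwiseLinear hψ hM hM0, ?_, ?_⟩, hψV, hψ⟩,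
    hχψ.mono fun x hx => by simp only [f, hx]⟩
  · filter_upwards [hfst.eventually hinj] with z hz
    exact (map_eq_zero_iff _ hz).symm
  · filter_upwards [hfst.eventually hinj, hfst.eventually hχψ] with z hz hχz
    simp only [MapGerm.graph, Set.mem_ofPred_eq, fiberwiseLinear, f, hχz]
    exact hz.eq_iff.symm

theorem exists_vk1Equiv_of_matrix {ψ : MapGerm 𝕜 p p} (hψ : HasOneJetId ψ.toFun)
    (hψV : MapsGermOnto ψ.toFun V V) {B : Matrix (Fin q) (Fin q) (Ep 𝕜 p)}
    (hB : ∀ i j, B i j ∈ maxIdeal 𝕜 p) (g : MapGerm 𝕜 p q) :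
    ∃ f : MapGerm 𝕜 p q, VK1Equiv V g f ∧
      ∀ j, ψ.pullback (f.comps j) = g.comps j + ∑ l, B j l * g.comps l := by
  choose b hb hBb using fun i j => (B i j).exists_rep
  have hb0 : (fun i j => b i j 0) = 0 := funext₂ fun i j => mk_mem_maxIdeal.1 (hBb i j ▸ hB i j)
  let L : (Fin q → Fin q → 𝕜) →L[𝕜] (Fin q → 𝕜) →L[𝕜] (Fin q → 𝕜) :=
    LinearMap.toContinuousLinearMap
      (LinearMap.toContinuousLinearMap.toLinearMap ∘ₗ (Matrix.toLin' (R := 𝕜)).toLinearMap)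
  have hL : SmoothNear 𝕜 (fun x => L fun i j => b i j x) 0 :=
    (SmoothNear.of_contDiff L.contDiff).comp (smoothNear_pi.2 fun i => smoothNear_pi.2 (hb i)) rfl
  obtain ⟨f, hf, hfψ⟩ := exists_vk1Equiv_of_fiberwiseLinear hψ hψV
    (M := fun x => .id 𝕜 _ + L fun i j => b i j x)
    ((SmoothNear.of_contDiff contDiff_const).fun_add hL) (by simp [hb0]) g
  refine ⟨f, hf, fun j => ?_⟩
  simp only [comps_eq_mkPi, Ep.mkPi, hBb, Ep.mk_mul, pullback_mk]
  rw [Ep.mk_sum fun l => (hb j l).fun_mul (smoothNear_pi.1 g.smooth' l), Ep.mk_add, Ep.mk_eq_mk]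
  filter_upwards [hfψ] with x hx using congr_fun hx j

end Equivalences

section Polynomials

variable {𝕜 : Type*} [RCLike 𝕜] {p q : ℕ}

/-- The `i`-th coordinate function, as a germ in `ℰ_p`. -/
def Ep.coord (i : Fin p) : Ep 𝕜 p :=
  Ep.mk (fun x => x i) (.of_contDiff (contDiff_apply 𝕜 𝕜 i))

/-- The germ at `0` of a polynomial function. -/
def polyHom : MvPolynomial (Fin p) 𝕜 →+* Ep 𝕜 p :=
  MvPolynomial.eval₂Hom Ep.const Ep.coord

theorem polyHom_eq_mk (P : MvPolynomial (Fin p) 𝕜) :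
    polyHom P = Ep.mk (fun x => MvPolynomial.eval x P)
      (.of_contDiff (AnalyticOnNhd.eval_mvPolynomial P).contDiff) := by
  induction P using MvPolynomial.induction_on with
  | C c =>
    rw [polyHom, MvPolynomial.coe_eval₂Hom, MvPolynomial.eval₂_C]
    exact Ep.mk_congr (hf := .of_contDiff contDiff_const) fun x => (MvPolynomial.eval_C c).symm
  | add P Q hP hQ =>
    rw [map_add, hP, hQ, Ep.mk_add]
    exact Ep.mk_congr fun x => (map_add _ P Q).symm
  | mul_X P i hP =>
    rw [map_mul, hP, polyHom, MvPolynomial.coe_eval₂Hom, MvPolynomial.eval₂_X, Ep.coord, Ep.mk_mul]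
    exact Ep.mk_congr fun x => by rw [map_mul, MvPolynomial.eval_X]

theorem polyGerm_apply (P : Fin q → MvPolynomial (Fin p) 𝕜) (j : Fin q) :
    polyGerm P j = polyHom (P j) :=
  (polyHom_eq_mk (P j)).symm

theorem degree_eq_of_isHomogeneous {P : MvPolynomial (Fin p) 𝕜} {n : ℕ} (hP : P.IsHomogeneous n)
    {d : Fin p →₀ ℕ} (hd : d ∈ P.support) : ∑ i, d i = n := by
  rw [← Finsupp.degree_eq_sum, Finsupp.degree_eq_weight_one]
  exact hP (MvPolynomial.mem_support_iff.1 hd)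

theorem eval_smul_of_isHomogeneous {P : MvPolynomial (Fin p) 𝕜} {n : ℕ} (hP : P.IsHomogeneous n)
    (t : 𝕜) (x : Fin p → 𝕜) : MvPolynomial.eval (t • x) P = t ^ n • MvPolynomial.eval x P := by
  rw [MvPolynomial.eval_eq', MvPolynomial.eval_eq', Finset.smul_sum]
  refine Finset.sum_congr rfl fun d hd => ?_
  simp only [Pi.smul_apply, smul_eq_mul, mul_pow, Finset.prod_mul_distrib]
  rw [Finset.prod_pow_eq_pow_sum, degree_eq_of_isHomogeneous hP hd, mul_left_comm]

theorem polyHom_mem_span_coord_pow {P : MvPolynomial (Fin p) 𝕜} {n : ℕ}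
    (hP : P.IsHomogeneous n) :
    polyHom P ∈ Ideal.span (Set.range (Ep.coord (𝕜 := 𝕜) (p := p))) ^ n := by
  rw [polyHom, MvPolynomial.coe_eval₂Hom, MvPolynomial.eval₂_eq']
  refine Ideal.sum_mem _ fun d hd => Ideal.mul_mem_left _ _ ?_
  rw [← degree_eq_of_isHomogeneous hP hd, ← Finset.prod_pow_eq_pow_sum]
  exact Ideal.prod_mem_prod fun i _ =>
    Ideal.pow_mem_pow (Ideal.subset_span (Set.mem_range_self i)) _

theorem span_coord_le_maxIdeal :
    Ideal.span (Set.range (Ep.coord (𝕜 := 𝕜) (p := p))) ≤ maxIdeal 𝕜 p := by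
  rw [Ideal.span_le]
  rintro _ ⟨i, rfl⟩
  exact mk_mem_maxIdeal.2 rfl

theorem polyHom_mem_maxIdeal_pow {P : MvPolynomial (Fin p) 𝕜} {n : ℕ} (hP : P.IsHomogeneous n) :
    polyHom P ∈ maxIdeal 𝕜 p ^ n :=
  Ideal.pow_right_mono span_coord_le_maxIdeal n (polyHom_mem_span_coord_pow hP)

/-- The homogeneous part of degree `n` of the Taylor series of `f` at `0`. -/
def homPart (n : ℕ) (f : (Fin p → 𝕜) → 𝕜) : MvPolynomial (Fin p) 𝕜 :=
  ∑ r : Fin n → Fin p,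
    MvPolynomial.C ((n.factorial : 𝕜)⁻¹ * iteratedFDeriv 𝕜 n f 0 fun i => Pi.single (r i) 1) *
      ∏ i, MvPolynomial.X (r i)

theorem isHomogeneous_homPart (n : ℕ) (f : (Fin p → 𝕜) → 𝕜) : (homPart n f).IsHomogeneous n := by
  refine MvPolynomial.IsHomogeneous.sum _ _ _ fun r _ => ?_
  have hprod := MvPolynomial.IsHomogeneous.prod Finset.univ
    (fun i => MvPolynomial.X (R := 𝕜) (r i)) (fun _ => 1)
    fun i _ => MvPolynomial.isHomogeneous_X 𝕜 (r i)
  rw [Finset.sum_const, Finset.card_univ, Fintype.card_fin, smul_eq_mul, mul_one] at hprod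
  exact hprod.C_mul _

theorem eval_homPart (n : ℕ) (f : (Fin p → 𝕜) → 𝕜) (x : Fin p → 𝕜) :
    MvPolynomial.eval x (homPart n f) =
      (n.factorial : 𝕜)⁻¹ • iteratedFDeriv 𝕜 n f 0 fun _ => x := by
  conv_rhs => rw [pi_eq_sum_univ' x, ContinuousMultilinearMap.map_sum, Finset.smul_sum]
  simp only [homPart, map_sum, map_mul, MvPolynomial.eval_C, map_prod, MvPolynomial.eval_X]
  refine Finset.sum_congr rfl fun r _ => ?_
  rw [ContinuousMultilinearMap.map_smul_univ, smul_eq_mul, smul_eq_mul]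
  ring

theorem mk_sub_sum_homPart_mem {f : (Fin p → 𝕜) → 𝕜} (hf : SmoothNear 𝕜 f 0) (n : ℕ) :
    Ep.mk f hf - ∑ m ∈ Finset.range n, polyHom (homPart m f) ∈ vanishIdeal 𝕜 p n := by
  rw [← map_sum, polyHom_eq_mk, Ep.mk_sub, mk_mem_vanishIdeal]
  simp only [map_sum, eval_homPart]
  exact hf.sub_taylorSum_isBigO n

theorem homPart_eq_of_mk_sub_sum_mem {f : (Fin p → 𝕜) → 𝕜} {hf : SmoothNear 𝕜 f 0} {n : ℕ}
    {P : ℕ → MvPolynomial (Fin p) 𝕜} (hP : ∀ m < n, (P m).IsHomogeneous m)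
    (h : Ep.mk f hf - ∑ m ∈ Finset.range n, polyHom (P m) ∈ vanishIdeal 𝕜 p n) :
    ∀ m < n, homPart m f = P m := by
  rw [← map_sum, polyHom_eq_mk, Ep.mk_sub, mk_mem_vanishIdeal] at h
  simp only [map_sum] at h
  intro m hm
  refine MvPolynomial.funext fun x => ?_
  rw [eval_homPart]
  exact hf.smul_iteratedFDeriv_eq_of_isBigO
    (c := fun m x => MvPolynomial.eval x (P m))
    (fun m hm => eval_smul_of_isHomogeneous (hP m hm)) h m hm x

theorem jet_apply (k : ℕ) (h : MapGerm 𝕜 p q) (x : Fin p → 𝕜) (j : Fin q) :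
    jet k h x j = MvPolynomial.eval x
      (∑ n ∈ Finset.range (k + 1), homPart n fun x => h.toFun x j) := by
  rw [jet, Finset.sum_apply, map_sum]
  refine Finset.sum_congr rfl fun n _ => ?_
  have hcomp := (ContinuousLinearMap.proj (R := 𝕜) (φ := fun _ : Fin q => 𝕜)
    j).iteratedFDeriv_comp_left h.smooth'.self_of_nhds (i := n) (by exact_mod_cast le_top)
  rw [eval_homPart, Pi.smul_apply]
  exact congr_arg _ (DFunLike.congr_fun hcomp fun _ => x).symm

theorem comps_sub_mem_of_jet_eq {k : ℕ} {g h : MapGerm 𝕜 p q} (hgh : jet k h = jet k g)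
    (j : Fin q) : g.comps j - h.comps j ∈ vanishIdeal 𝕜 p (k + 1) := by
  have hpoly : ∑ n ∈ Finset.range (k + 1), homPart n (fun x => h.toFun x j) =
      ∑ n ∈ Finset.range (k + 1), homPart n fun x => g.toFun x j :=
    MvPolynomial.funext fun x => by rw [← jet_apply, ← jet_apply, hgh]
  have hsub := sub_mem (mk_sub_sum_homPart_mem (smoothNear_pi.1 g.smooth' j) (k + 1))
    (mk_sub_sum_homPart_mem (smoothNear_pi.1 h.smooth' j) (k + 1))
  rwa [← map_sum, ← map_sum, hpoly, sub_sub_sub_cancel_right] at hsub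

theorem jet_succ_of_comps_sub_mem {k : ℕ} {f g : MapGerm 𝕜 p q}
    {P : Fin q → MvPolynomial (Fin p) 𝕜} (hP : ∀ j, (P j).IsHomogeneous (k + 1))
    (h : ∀ j, f.comps j - (g.comps j - polyHom (homPart (k + 1) (fun x => g.toFun x j) - P j)) ∈
      vanishIdeal 𝕜 p (k + 2)) (x : Fin p → 𝕜) :
    jet (k + 1) f x = jet k g x + fun j => MvPolynomial.eval x (P j) := by
  ext j
  obtain ⟨Q, hQlt, hQ⟩ : ∃ Q : ℕ → MvPolynomial (Fin p) 𝕜,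
      (∀ n ∈ Finset.range (k + 1), Q n = homPart n fun x => g.toFun x j) ∧ Q (k + 1) = P j :=
    ⟨Function.update (fun n => homPart n fun x => g.toFun x j) (k + 1) (P j),
      fun n hn => Function.update_of_ne (Finset.mem_range.1 hn).ne _ _, Function.update_self ..⟩
  have hhom : ∀ n < k + 2, (Q n).IsHomogeneous n := by
    intro n hn
    rcases Nat.lt_succ_iff_lt_or_eq.1 hn with hn | rfl
    · exact hQlt n (Finset.mem_range.2 hn) ▸ isHomogeneous_homPart n _
    · exact hQ ▸ hP j
  have hmem := add_mem (h j) (mk_sub_sum_homPart_mem (smoothNear_pi.1 g.smooth' j) (k + 2))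
  have hfQ := homPart_eq_of_mk_sub_sum_mem (hf := smoothNear_pi.1 f.smooth' j) hhom <| by
    convert hmem using 1
    rw [Finset.sum_range_succ, Finset.sum_range_succ _ (k + 1), hQ,
      Finset.sum_congr rfl fun n hn => congr_arg polyHom (hQlt n hn), map_sub]
    simp only [comps_eq_mkPi, Ep.mkPi]
    ring
  rw [Pi.add_apply, jet_apply, jet_apply,
    Finset.sum_congr rfl fun n hn => hfQ n (Finset.mem_range.1 hn), Finset.sum_range_succ, hQ,
    Finset.sum_congr rfl hQlt, map_add]

theorem maxIdeal_le_span_coord_sup (n : ℕ) :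
    maxIdeal 𝕜 p ≤ Ideal.span (Set.range Ep.coord) ⊔ vanishIdeal 𝕜 p n := by
  intro a ha
  obtain ⟨f, hf, rfl⟩ := a.exists_rep
  rw [← sub_add_cancel (Ep.mk f hf) (∑ m ∈ Finset.range n, polyHom (homPart m f)), add_comm]
  refine Submodule.add_mem_sup (Ideal.sum_mem _ fun m _ => ?_) (mk_sub_sum_homPart_mem hf n)
  cases m with
  | zero =>
    have hzero : homPart 0 f = 0 := MvPolynomial.funext fun x => by
      rw [eval_homPart]
      simpa using mk_mem_maxIdeal.1 ha
    rw [hzero, map_zero]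
    exact zero_mem _
  | succ m =>
    exact Ideal.pow_le_self m.succ_ne_zero (polyHom_mem_span_coord_pow (isHomogeneous_homPart _ f))

theorem map_pullback_maxIdeal_le (h : MapGerm 𝕜 p q) (n : ℕ) :
    (maxIdeal 𝕜 q).map h.pullback ≤ Ideal.span (Set.range h.comps) ⊔ vanishIdeal 𝕜 p n := by
  refine (Ideal.map_mono (maxIdeal_le_span_coord_sup n)).trans ?_
  rw [Ideal.map_sup, Ideal.map_span, ← Set.range_comp]
  exact sup_le_sup_left (Ideal.map_le_iff_le_comap.2 fun _ => pullback_mem_vanishIdeal h) _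

end Polynomials

section Ideals

variable {R ι : Type*} [CommRing R]

theorem exists_sub_sum_mem_of_mem_mul_span_sup [Fintype ι] {I K : Ideal R} {g : ι → R} {a : R}
    (ha : a ∈ I * Ideal.span (Set.range g) ⊔ K) :
    ∃ b : ι → R, (∀ i, b i ∈ I) ∧ a - ∑ i, b i * g i ∈ K := by
  obtain ⟨y, hy, z, hz, rfl⟩ := Submodule.mem_sup.1 ha
  rw [← smul_eq_mul, ← Ideal.submodule_span_eq, Submodule.mem_ideal_smul_span_iff_exists_sum] at hy
  obtain ⟨b, hb, rfl⟩ := hy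
  have hsum : (b.sum fun i c => c • g i) = ∑ i, b i * g i :=
    Finsupp.sum_fintype _ _ fun _ => zero_smul _ _
  exact ⟨b, hb, by rwa [hsum, add_sub_cancel_left]⟩

theorem derivation_mem_of_mem_span {D : Derivation ℤ R R} {S : Set R} {K : Ideal R}
    (hS : ∀ a ∈ S, D a ∈ Ideal.span S ⊔ K) {a : R} (ha : a ∈ Ideal.span S) :
    D a ∈ Ideal.span S ⊔ K := by
  induction ha using Submodule.span_induction with
  | mem a ha => exact hS a ha
  | zero => rw [map_zero]; exact zero_mem _
  | add a b _ _ hDa hDb => rw [map_add]; exact add_mem hDa hDb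
  | smul c a ha hDa =>
    rw [smul_eq_mul, D.leibniz, smul_eq_mul, smul_eq_mul]
    exact add_mem (Ideal.mul_mem_left _ _ hDa)
      (Ideal.mul_mem_right _ _ (Submodule.mem_sup_left ha))

theorem derivation_mem_mul_sup {D : Derivation ℤ R R} {I J K L : Ideal R}
    (hI : ∀ a ∈ I, D a ∈ I) (hJ : ∀ a ∈ J, D a ∈ J ⊔ K) (hL : ∀ a ∈ L, D a ∈ L)
    (hIK : I * K ≤ L) : ∀ a ∈ I * J ⊔ L, D a ∈ I * J ⊔ L := by
  have hprod : ∀ a ∈ I * J, D a ∈ I * J ⊔ L := by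
    intro a ha
    induction ha using Submodule.mul_induction_on' with
    | mem_mul_mem a ha b hb =>
      rw [D.leibniz, smul_eq_mul, smul_eq_mul]
      refine add_mem (?_ : a * D b ∈ _) (Submodule.mem_sup_left ?_)
      · have hmem := Ideal.mul_mem_mul ha (hJ b hb)
        rw [Ideal.mul_sup] at hmem
        exact sup_le_sup_left hIK _ hmem
      · rw [mul_comm b]
        exact Ideal.mul_mem_mul (hI a ha) hb
    | add a _ b _ hDa hDb => rw [map_add]; exact add_mem hDa hDb
  intro a ha
  obtain ⟨y, hy, z, hz, rfl⟩ := Submodule.mem_sup.1 ha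
  rw [map_add]
  exact add_mem (hprod y hy) (Submodule.mem_sup_right (hL z hz))

theorem apply_mem_of_mem_smul_top {I : Ideal R} {w : ι → R}
    (hw : w ∈ I • (⊤ : Submodule R (ι → R))) (i : ι) : w i ∈ I :=
  Submodule.smul_induction_on hw (fun _ hr _ _ => Ideal.mul_mem_right _ _ hr)
    fun _ _ hx hy => add_mem hx hy

theorem mem_smul_top_of_apply_mem [Finite ι] {I : Ideal R} {w : ι → R} (hw : ∀ i, w i ∈ I) :
    w ∈ I • (⊤ : Submodule R (ι → R)) := by
  classical
  cases nonempty_fintype ι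
  rw [pi_eq_sum_univ' w]
  exact Submodule.sum_mem _ fun i _ => Submodule.smul_mem_smul (hw i) trivial

end Ideals

section CompleteTransversal

variable {𝕜 : Type*} [RCLike 𝕜] {p q : ℕ} {V : Set (Fin p → 𝕜)}

theorem mem_vanishIdeal_of_mem_theta1 {ξ : Fin p → Ep 𝕜 p} (hξ : ξ ∈ Theta1 V) (i : Fin p) :
    ξ i ∈ vanishIdeal 𝕜 p 2 := by
  obtain ⟨X, hX, rfl, Φ, δ, C, H⟩ := exists_isUniformFlow hξ
  exact Ep.mkPi_mem_vanishIdeal.2 H.field_isBigO i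

theorem fieldDer_mem_maxIdeal_mul_span_sup {ξ : Fin p → Ep 𝕜 p}
    (hξ : ∀ i, ξ i ∈ vanishIdeal 𝕜 p 2) {g : Fin q → Ep 𝕜 p} {n : ℕ}
    (hg : ∀ j, fieldDer ξ (g j) ∈ Ideal.span (Set.range g) ⊔ vanishIdeal 𝕜 p n) :
    ∀ a ∈ maxIdeal 𝕜 p * Ideal.span (Set.range g) ⊔ vanishIdeal 𝕜 p (n + 1),
      fieldDer ξ a ∈ maxIdeal 𝕜 p * Ideal.span (Set.range g) ⊔ vanishIdeal 𝕜 p (n + 1) := by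
  refine derivation_mem_mul_sup (fun a ha => ?_)
    (fun a => derivation_mem_of_mem_span (Set.forall_mem_range.2 hg))
    (fun a ha => vanishIdeal_anti n.succ.le_succ (fieldDer_mem_vanishIdeal hξ ha))
    (maxIdeal_mul_vanishIdeal_le n)
  rw [← vanishIdeal_one] at ha ⊢
  exact vanishIdeal_anti one_le_two (fieldDer_mem_vanishIdeal hξ ha)

theorem exists_vk1Equiv_comps_sub_mem {ξ : Fin p → Ep 𝕜 p} (hξ : ξ ∈ Theta1 V)
    {g : MapGerm 𝕜 p q} {n : ℕ} {e : Fin q → Ep 𝕜 p} (he : ∀ j, e j ∈ vanishIdeal 𝕜 p n)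
    {B : Matrix (Fin q) (Fin q) (Ep 𝕜 p)} (hB : ∀ i j, B i j ∈ maxIdeal 𝕜 p)
    (heB : ∀ j, e j - (fieldDer ξ (g.comps j) + ∑ l, B j l * g.comps l) ∈
      vanishIdeal 𝕜 p (n + 1)) :
    ∃ f : MapGerm 𝕜 p q, VK1Equiv V g f ∧
      ∀ j, f.comps j - (g.comps j - e j) ∈ vanishIdeal 𝕜 p (n + 1) := by
  have hξ2 := mem_vanishIdeal_of_mem_theta1 hξ
  set J := Ideal.span (Set.range g.comps)
  set N := maxIdeal 𝕜 p * J ⊔ vanishIdeal 𝕜 p (n + 1)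
  have hDg (j : Fin q) : fieldDer ξ (g.comps j) - e j ∈ N := by
    have hBg : ∑ l, B j l * g.comps l ∈ maxIdeal 𝕜 p * J := Ideal.sum_mem _ fun l _ =>
      Ideal.mul_mem_mul (hB j l) (Ideal.subset_span (Set.mem_range_self l))
    convert neg_mem (add_mem (Submodule.mem_sup_left hBg) (Submodule.mem_sup_right (heB j))) using 1
    ring
  have hNJ : N ≤ J ⊔ vanishIdeal 𝕜 p n := sup_le_sup Ideal.mul_le_right (vanishIdeal_anti n.le_succ)
  have hDN : ∀ a ∈ N, fieldDer ξ a ∈ N := fieldDer_mem_maxIdeal_mul_span_sup hξ2 fun j =>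
    (Submodule.sub_mem_iff_left _ (Submodule.mem_sup_right (he j))).1 (hNJ (hDg j))
  have hDe (j : Fin q) : fieldDer ξ (e j) ∈ N :=
    Submodule.mem_sup_right (fieldDer_mem_vanishIdeal hξ2 (he j))
  obtain ⟨ψ, hψ⟩ := exists_isFlowMapMod_one hξ le_sup_right hDN
  have hψg (j : Fin q) : ψ.pullback (g.comps j - e j) - g.comps j ∈ N := by
    have hDD : fieldDer ξ (fieldDer ξ (g.comps j - e j)) ∈ N := by
      convert sub_mem (add_mem (hDN _ (hDg j)) (hDe j)) (hDN _ (hDe j)) using 1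
      simp only [map_sub]
      ring
    convert add_mem (hψ.pullback_sub_mem _ hDD) (sub_mem (hDg j) (hDe j)) using 1
    simp only [map_one, one_mul, map_sub]
    ring
  choose A hA hAg using fun j => exists_sub_sum_mem_of_mem_mul_span_sup (hψg j)
  obtain ⟨f, hf, hfA⟩ := exists_vk1Equiv_of_matrix hψ.oneJet hψ.preserves (B := A) hA g
  refine ⟨f, hf, fun j => mem_vanishIdeal_of_pullback hψ.oneJet ?_⟩
  convert neg_mem (hAg j) using 1
  rw [map_sub, hfA j]
  ring

theorem exists_matrix_of_mem_smul_top {h : MapGerm 𝕜 p q} {w : Fin q → Ep 𝕜 p}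
    (hw : w ∈ (maxIdeal 𝕜 p * (maxIdeal 𝕜 q).map h.pullback) •
      (⊤ : Submodule (Ep 𝕜 p) (Fin q → Ep 𝕜 p))) (n : ℕ) :
    ∃ B : Matrix (Fin q) (Fin q) (Ep 𝕜 p), (∀ i j, B i j ∈ maxIdeal 𝕜 p) ∧
      ∀ j, w j - ∑ l, B j l * h.comps l ∈ vanishIdeal 𝕜 p n := by
  have hle : maxIdeal 𝕜 p * (maxIdeal 𝕜 q).map h.pullback ≤
      maxIdeal 𝕜 p * Ideal.span (Set.range h.comps) ⊔ vanishIdeal 𝕜 p n := by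
    refine (Ideal.mul_mono_right (map_pullback_maxIdeal_le h n)).trans ?_
    rw [Ideal.mul_sup]
    exact sup_le_sup_left Ideal.mul_le_right _
  choose B hB hBw using fun j =>
    exists_sub_sum_mem_of_mem_mul_span_sup (hle (apply_mem_of_mem_smul_top hw j))
  exact ⟨B, hB, hBw⟩

theorem exists_sub_mem_of_subset_tangentK1_add {h : MapGerm 𝕜 p q} {n s : ℕ}
    {G : Fin s → Fin q → MvPolynomial (Fin p) 𝕜}
    (hT : (powTheta 𝕜 p q n : Set (Fin q → Ep 𝕜 p)) ⊆
      tangentK1 V h + polyGerm '' (Submodule.span 𝕜 (Set.range G) : Set _) +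
        (powTheta 𝕜 p q (n + 1) : Set (Fin q → Ep 𝕜 p)))
    {P : Fin q → MvPolynomial (Fin p) 𝕜} (hP : ∀ j, (P j).IsHomogeneous n) :
    ∃ ξ ∈ Theta1 V, ∃ (α : Fin s → 𝕜) (B : Matrix (Fin q) (Fin q) (Ep 𝕜 p)),
      (∀ i j, B i j ∈ maxIdeal 𝕜 p) ∧ ∀ j, polyHom (P j - ∑ i, α i • G i j) -
        (fieldDer ξ (h.comps j) + ∑ l, B j l * h.comps l) ∈ vanishIdeal 𝕜 p (n + 1) := by
  have hPmem : polyGerm P ∈ powTheta 𝕜 p q n := mem_smul_top_of_apply_mem fun j => by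
    rw [polyGerm_apply]
    exact polyHom_mem_maxIdeal_pow (hP j)
  obtain ⟨_, ⟨_, ⟨_, ⟨ξ, hξ, rfl⟩, w, hw, rfl⟩, _, ⟨Q, hQ, rfl⟩, rfl⟩, r, hr, hsum⟩ := hT hPmem
  obtain ⟨α, rfl⟩ := (Submodule.mem_span_range_iff_exists_fun 𝕜).1 hQ
  obtain ⟨B, hB, hBw⟩ := exists_matrix_of_mem_smul_top hw (n + 1)
  refine ⟨ξ, hξ, α, B, hB, fun j => ?_⟩
  have hrj := maxIdeal_pow_le_vanishIdeal (n + 1) (apply_mem_of_mem_smul_top hr j)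
  convert add_mem (hBw j) hrj using 1
  have hj : applyField ξ h j + w j + polyGerm (∑ i, α i • G i) j + r j = polyGerm P j :=
    congr_fun hsum j
  rw [polyGerm_apply, polyGerm_apply, Finset.sum_apply] at hj
  rw [map_sub, ← hj, fieldDer_apply, applyField]
  simp only [Pi.smul_apply]
  ring

theorem sub_fieldDer_add_sum_mem_congr {ξ : Fin p → Ep 𝕜 p} (hξ : ∀ i, ξ i ∈ vanishIdeal 𝕜 p 2)
    {g h : Fin q → Ep 𝕜 p} {n : ℕ} (hgh : ∀ j, g j - h j ∈ vanishIdeal 𝕜 p n)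
    {B : Fin q → Ep 𝕜 p} (hB : ∀ j, B j ∈ maxIdeal 𝕜 p) {a : Ep 𝕜 p} {j : Fin q}
    (ha : a - (fieldDer ξ (h j) + ∑ l, B l * h l) ∈ vanishIdeal 𝕜 p (n + 1)) :
    a - (fieldDer ξ (g j) + ∑ l, B l * g l) ∈ vanishIdeal 𝕜 p (n + 1) := by
  have hsum : ∑ l, B l * (g l - h l) ∈ vanishIdeal 𝕜 p (n + 1) := Ideal.sum_mem _ fun l _ =>
    maxIdeal_mul_vanishIdeal_le n (Ideal.mul_mem_mul (hB l) (hgh l))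
  convert sub_mem (sub_mem ha (fieldDer_mem_vanishIdeal hξ (hgh j))) hsum using 1
  simp only [map_sub, mul_sub, Finset.sum_sub_distrib]
  ring

end CompleteTransversal

end VK

end

open VK in
theorem theorem3p3_general {𝕜 : Type*} [RCLike 𝕜] {p q : ℕ} (h : MapGerm 𝕜 p q)
    (V : Set (Fin p → 𝕜)) (k s : ℕ)
    (G : Fin s → Fin q → MvPolynomial (Fin p) 𝕜) (hG : ∀ i j, (G i j).IsHomogeneous (k + 1))
    (hT : (powTheta 𝕜 p q (k + 1) : Set (Fin q → Ep 𝕜 p)) ⊆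
      tangentK1 V h + polyGerm '' (Submodule.span 𝕜 (Set.range G) : Set _) +
        (powTheta 𝕜 p q (k + 2) : Set (Fin q → Ep 𝕜 p)))
    (g : MapGerm 𝕜 p q) (hg : jet k h = jet k g) :
    ∃ (f : MapGerm 𝕜 p q) (α : Fin s → 𝕜), VK1Equiv V g f ∧
      ∀ x : Fin p → 𝕜, jet (k + 1) f x =
        jet k h x + ∑ i, α i • fun j => MvPolynomial.eval x (G i j) := by
  have hhom (j : Fin q) := isHomogeneous_homPart (k + 1) fun x => g.toFun x j
  obtain ⟨ξ, hξ, α, B, hB, hα⟩ := exists_sub_mem_of_subset_tangentK1_add hT hhom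
  have hαG (j : Fin q) : (∑ i, α i • G i j).IsHomogeneous (k + 1) :=
    .sum _ _ _ fun i _ => MvPolynomial.smul_eq_C_mul (G i j) (α i) ▸ (hG i j).C_mul _
  obtain ⟨f, hf, hfg⟩ := exists_vk1Equiv_comps_sub_mem hξ
    (fun j => maxIdeal_pow_le_vanishIdeal _ (polyHom_mem_maxIdeal_pow ((hhom j).sub (hαG j)))) hB
    fun j => sub_fieldDer_add_sum_mem_congr (mem_vanishIdeal_of_mem_theta1 hξ)
      (comps_sub_mem_of_jet_eq hg) (hB j) (hα j)
  refine ⟨f, α, hf, fun x => ?_⟩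
  rw [jet_succ_of_comps_sub_mem hαG hfg x, hg]
  congr 1
  ext j
  simp only [map_sum, MvPolynomial.smul_eval, Finset.sum_apply, Pi.smul_apply, smul_eq_mul]

theorem theorem3p3 {𝕜 : Type*} [RCLike 𝕜] {p q : ℕ} (h : VK.MapGerm 𝕜 p q)
    (V : Set (Fin p → 𝕜)) (hV : VK.ThetaFG V) (k s : ℕ)
    (G : Fin s → Fin q → MvPolynomial (Fin p) 𝕜)
    (hG : ∀ i j, (G i j).IsHomogeneous (k + 1))
    (hT : (VK.powTheta 𝕜 p q (k + 1) : Set (Fin q → VK.Ep 𝕜 p)) ⊆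
      VK.tangentK1 V h + VK.polyGerm '' (Submodule.span 𝕜 (Set.range G) : Set _) +
        (VK.powTheta 𝕜 p q (k + 2) : Set (Fin q → VK.Ep 𝕜 p)))
    (g : VK.MapGerm 𝕜 p q) (hg : VK.jet k h = VK.jet k g) :
    ∃ (f : VK.MapGerm 𝕜 p q) (α : Fin s → 𝕜), VK.VK1Equiv V g f ∧
      ∀ x : Fin p → 𝕜, VK.jet (k + 1) f x =
        VK.jet k h x + ∑ i, α i • fun j => MvPolynomial.eval x (G i j) :=
  theorem3p3_general h V k s G hG hT g hg
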